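/- Let $(M,g)$ be an oriented Riemannian 4-manifold with Levi-Civita connection $D$. Assume that $g$ is Einstein, with scalar curvature $s$, and self-dual, i.e. the anti-self-dual part $W^-$ of its Weyl tensor vanishes. Suppose that $(M,g)$ carries a negative hyperhermitian structure, i.e. three integrable $g$-orthogonal almost-complex structures $I_1,I_2,I_3$ with $I_1\circ I_2=-I_2\circ I_1=I_3$ whose Kähler forms $F_i(X,Y)=g(I_iX,Y)$ are anti-self-dual. Let $\theta$ be its Lee form, i.e. the 1-form with $dF_i=-2\,\theta\wedge F_i$ (the same for $i=1,2,3$), and put $\Phi=d\theta$. Identify 1-forms with vector fields by means of $g$, and 2-forms $\psi$ with skew-symmetric endomorphisms $\Psi$ of the tangent bundle by $\psi(X,Y)=g(\Psi(X),Y)$; let $\psi(\theta)$ and $\Phi(\theta)$ denote the action of these endomorphisms and $[\cdot,\cdot]$ their commutator. Let the curvature $R_{X,Y}=D_{[X,Y]}-[D_X,D_Y]$ and the Weyl tensor act on 2-forms so that $R$ is the identity on the unit sphere. Then the self-dual Weyl tensor $W^+=\frac12(W+W\circ *)$, as an operator on self-dual 2-forms, is given at each point where $\theta\neq 0$ by $$W^+(\psi)=\tfrac12[\psi,\Phi]+\frac{1}{|\theta|^2}\,D_{\psi(\theta)}\Phi$$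 for every self-dual 2-form $\psi$. Moreover, everywhere on $M$, $$D_\theta\Phi=2|\theta|^2\,\Phi,\qquad d|\theta|^2-\Big(\frac{s}{12}+|\theta|^2\Big)\theta+\Phi(\theta)=0 .$$ -/

import Mathlib

open scoped Manifold ContDiff

noncomputable section

namespace FourDim

/-- The model space `ℝ⁴`. -/
abbrev E4 : Type := EuclideanSpace ℝ (Fin 4)

/-- `4 × 4` real matrices: components, in a coordinate frame, of bilinear forms
(`B i j = B(∂ᵢ, ∂ⱼ)`) and of endomorphisms (`A ∂ⱼ = ∑ i, A i j ∂ᵢ`). -/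
abbrev Mat : Type := Matrix (Fin 4) (Fin 4) ℝ

/-! ### Pointwise algebra, `g` being the Gram matrix of the metric in a positively oriented frame -/

section Pointwise

/-- The vector dual to a covector. -/
def sharp (g : Mat) (α : Fin 4 → ℝ) : Fin 4 → ℝ := fun a => ∑ b, g⁻¹ a b * α b

/-- The square of the norm of a covector. -/
def normSq (g : Mat) (α : Fin 4 → ℝ) : ℝ := ∑ a, sharp g α a * α a

/-- The contravariant components of a 2-form. -/
def raise (g : Mat) (ψ : Mat) : Mat :=
  Matrix.of fun i j => ∑ a, ∑ b, g⁻¹ i a * g⁻¹ j b * ψ a b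

/-- The Levi-Civita symbol with `ε 0 1 2 3 = 1`. -/
def eps (i j k l : Fin 4) : ℝ :=
  (Matrix.of fun a b : Fin 4 => if ![i, j, k, l] a = b then (1 : ℝ) else 0).det

/-- The Hodge star operator on 2-forms. -/
def hodge (g : Mat) (ψ : Mat) : Mat :=
  Matrix.of fun k l => (1 / 2) * √g.det * ∑ i, ∑ j, raise g ψ i j * eps i j k l

/-- The endomorphism `Ψ` attached to a 2-form `ψ` by `ψ(X, Y) = g(Ψ X, Y)`. -/
def toEndo (g : Mat) (ψ : Mat) : Mat := Matrix.of fun k i => ∑ j, ψ i j * g⁻¹ j k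

/-- The bilinear form `(X, Y) ↦ g(A X, Y)` attached to an endomorphism `A`. -/
def toForm (g : Mat) (A : Mat) : Mat := Matrix.of fun i j => ∑ k, A k i * g k j

/-- The commutator of two 2-forms, viewed as endomorphisms. -/
def bracket (g : Mat) (ψ φ : Mat) : Mat :=
  toForm g (toEndo g ψ * toEndo g φ - toEndo g φ * toEndo g ψ)

/-- `ψ` is a 2-form with `∗ψ = ψ`. -/
def IsSelfDualForm (g : Mat) (ψ : Mat) : Prop := ψ.transpose = -ψ ∧ hodge g ψ = ψ

/-- `ψ` is a 2-form with `∗ψ = -ψ`. -/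
def IsAntiSelfDualForm (g : Mat) (ψ : Mat) : Prop := ψ.transpose = -ψ ∧ hodge g ψ = -ψ

end Pointwise

/-! ### Tensor calculus on an open set of `ℝ⁴`; `G` is the metric, as a function of the point -/

section Local

/-- The partial derivative `∂ᵢ f`. -/
def pd (i : Fin 4) (f : E4 → ℝ) (u : E4) : ℝ := fderiv ℝ f u (EuclideanSpace.single i 1)

/-- The Christoffel symbols of the Levi-Civita connection: `D_{∂ᵢ} ∂ⱼ = ∑ k, Γᵏᵢⱼ ∂ₖ`. -/
def christoffel (G : E4 → Mat) (u : E4) (k i j : Fin 4) : ℝ :=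
  (1 / 2) * ∑ l, (G u)⁻¹ k l *
    (pd i (fun v => G v j l) u + pd j (fun v => G v i l) u - pd l (fun v => G v i j) u)

/-- The Riemannian curvature `R_{X,Y} = D_{[X,Y]} - [D_X, D_Y]`:
`R_{∂ᵢ,∂ⱼ} ∂ₖ = ∑ l, (riemann G u i j k l) ∂ₗ`. -/
def riemann (G : E4 → Mat) (u : E4) (i j k l : Fin 4) : ℝ :=
  -(pd i (fun v => christoffel G v l j k) u - pd j (fun v => christoffel G v l i k) u
    + ∑ m, (christoffel G u l i m * christoffel G u m j k
      - christoffel G u l j m * christoffel G u m i k))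

/-- The curvature with all indices down: `g(R_{∂ᵢ,∂ⱼ} ∂ₖ, ∂ₗ)`. -/
def riemannLow (G : E4 → Mat) (u : E4) (i j k l : Fin 4) : ℝ :=
  ∑ m, riemann G u i j k m * G u m l

/-- The Ricci tensor `Ric(X, Y) = tr (Z ↦ R_{X,Z} Y)`. -/
def ricci (G : E4 → Mat) (u : E4) : Mat := Matrix.of fun i k => ∑ j, riemann G u i j k j

/-- The scalar curvature. -/
def scal (G : E4 → Mat) (u : E4) : ℝ := ∑ i, ∑ k, (G u)⁻¹ i k * ricci G u i k

/-- The trace-free Ricci tensor. -/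
def ricci₀ (G : E4 → Mat) (u : E4) : Mat := ricci G u - (scal G u / 4) • G u

/-- The Weyl tensor `W = R - (s/12) Id - (1/2) Ric₀~`, with all indices down, where
`Ric₀~ (X ∧ Y) = Ric₀(X) ∧ Y + X ∧ Ric₀(Y)`. -/
def weyl (G : E4 → Mat) (u : E4) (i j k l : Fin 4) : ℝ :=
  riemannLow G u i j k l
    - scal G u / 12 * (G u i k * G u j l - G u i l * G u j k)
    - (1 / 2) * (ricci₀ G u i k * G u j l - ricci₀ G u i l * G u j k
      + G u i k * ricci₀ G u j l - G u i l * ricci₀ G u j k)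

/-- The Weyl tensor as an operator on 2-forms (the operator attached in the same way to
`G i k * G j l - G i l * G j k` is the identity). -/
def weylOp (G : E4 → Mat) (u : E4) (ψ : Mat) : Mat :=
  Matrix.of fun k l => (1 / 2) * ∑ i, ∑ j, raise (G u) ψ i j * weyl G u i j k l

/-- The self-dual Weyl tensor `W⁺ = (1/2) (W + W ∘ ∗)`. -/
def weylPlus (G : E4 → Mat) (u : E4) (ψ : Mat) : Mat :=
  (1 / 2 : ℝ) • (weylOp G u ψ + weylOp G u (hodge (G u) ψ))

/-- The anti-self-dual Weyl tensor `W⁻ = (1/2) (W - W ∘ ∗)`. -/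
def weylMinus (G : E4 → Mat) (u : E4) (ψ : Mat) : Mat :=
  (1 / 2 : ℝ) • (weylOp G u ψ - weylOp G u (hodge (G u) ψ))

/-- The exterior derivative of a 1-form. -/
def dOne (t : E4 → Fin 4 → ℝ) (u : E4) : Mat :=
  Matrix.of fun i j => pd i (fun v => t v j) u - pd j (fun v => t v i) u

/-- The exterior derivative of a 2-form. -/
def dTwo (F : E4 → Mat) (u : E4) (i j k : Fin 4) : ℝ :=
  pd i (fun v => F v j k) u + pd j (fun v => F v k i) u + pd k (fun v => F v i j) u

/-- The wedge product of a covector and a 2-form. -/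
def wedge (α : Fin 4 → ℝ) (ψ : Mat) (i j k : Fin 4) : ℝ :=
  α i * ψ j k + α j * ψ k i + α k * ψ i j

/-- The Levi-Civita covariant derivative `D_X ψ` of a 2-form `ψ` along a vector `X` at `u`. -/
def covDeriv (G : E4 → Mat) (ψ : E4 → Mat) (u : E4) (X : Fin 4 → ℝ) : Mat :=
  Matrix.of fun i j => ∑ a, X a * (pd a (fun v => ψ v i j) u
    - ∑ m, (christoffel G u m a i * ψ u m j + christoffel G u m a j * ψ u i m))

/-- The Nijenhuis tensor `N(X, Y) = [JX, JY] - J[JX, Y] - J[X, JY] + J²[X, Y]` of a field of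
endomorphisms: the `k`-th component of `N(∂ᵢ, ∂ⱼ)`. -/
def nijenhuis (J : E4 → Mat) (u : E4) (k i j : Fin 4) : ℝ :=
  ∑ l, (J u l i * pd l (fun v => J v k j) u - J u l j * pd l (fun v => J v k i) u
    - J u k l * (pd i (fun v => J v l j) u - pd j (fun v => J v l i) u))

end Local

/-! ### Structures on a 4-manifold -/

section Manifold

variable (M : Type*) [TopologicalSpace M] [ChartedSpace E4 M]

/-- An orientation of the smooth 4-manifold `M`: an atlas of smooth charts (the oriented charts)
whose transition maps have positive Jacobian determinant. -/
structure OrientedAtlas where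
  charts : Set (OpenPartialHomeomorph M E4)
  smooth : charts ⊆ IsManifold.maximalAtlas (𝓡 4) ∞ M
  cover : ∀ x : M, ∃ e ∈ charts, x ∈ e.source
  det_pos : ∀ e ∈ charts, ∀ e' ∈ charts, ∀ x ∈ e.source ∩ e'.source,
    0 < (fderiv ℝ (fun u => e' (e.symm u)) (e x)).det

variable [IsManifold (𝓡 4) ∞ M]

/-- Smooth Riemannian metrics on `M`. -/
abbrev Metric : Type _ :=
  Bundle.ContMDiffRiemannianMetric (𝓡 4) ∞ E4 (fun x : M => TangentSpace (𝓡 4) x)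

/-- Fields of endomorphisms of the tangent bundle. -/
abbrev EndoField : Type _ := ∀ x : M, TangentSpace (𝓡 4) x →L[ℝ] TangentSpace (𝓡 4) x

/-- Fields of covectors. -/
abbrev CovectorField : Type _ := ∀ x : M, TangentSpace (𝓡 4) x →L[ℝ] ℝ

variable {M}

/-- Smoothness of a field of endomorphisms. -/
def IsSmoothEndo (J : EndoField M) : Prop :=
  ContMDiff (𝓡 4) ((𝓡 4).prod 𝓘(ℝ, E4 →L[ℝ] E4)) ∞
    (fun x => Bundle.TotalSpace.mk' (E4 →L[ℝ] E4)
      (E := fun x : M => TangentSpace (𝓡 4) x →L[ℝ] TangentSpace (𝓡 4) x) x (J x))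

/-- Smoothness of a field of covectors, which is then a 1-form. -/
def IsSmoothOneForm (θ : CovectorField M) : Prop :=
  ContMDiff (𝓡 4) ((𝓡 4).prod 𝓘(ℝ, E4 →L[ℝ] ℝ)) ∞
    (fun x => Bundle.TotalSpace.mk' (E4 →L[ℝ] ℝ)
      (E := fun x : M => TangentSpace (𝓡 4) x →L[ℝ] ℝ) x (θ x))

/-- The coordinate vector `∂ᵢ` of the chart `e`, at the point of coordinates `u`. -/
def frame (e : OpenPartialHomeomorph M E4) (u : E4) (i : Fin 4) :
    TangentSpace (𝓡 4) (e.symm u) :=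
  mfderiv (𝓡 4) (𝓡 4) e.symm u (EuclideanSpace.single i (1 : ℝ) : E4)

/-- The components `g(∂ᵢ, ∂ⱼ)` of the metric in the chart `e`. -/
def metricIn (g : Metric M) (e : OpenPartialHomeomorph M E4) (u : E4) : Mat :=
  Matrix.of fun i j => g.inner (e.symm u) (frame e u i) (frame e u j)

/-- A tangent vector of `ℝ⁴`, as a vector of `ℝ⁴`. -/
def asVector {u : E4} (v : TangentSpace (𝓡 4) u) : E4 := v

/-- The components of a field of endomorphisms in the chart `e`: `J ∂ⱼ = ∑ i, J i j ∂ᵢ`. -/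
def endoIn (J : EndoField M) (e : OpenPartialHomeomorph M E4) (u : E4) : Mat :=
  Matrix.of fun i j =>
    asVector (mfderiv (𝓡 4) (𝓡 4) e (e.symm u) (J (e.symm u) (frame e u j))) i

/-- The components `θ(∂ᵢ)` of a field of covectors in the chart `e`. -/
def covectorIn (θ : CovectorField M) (e : OpenPartialHomeomorph M E4) (u : E4) : Fin 4 → ℝ :=
  fun i => θ (e.symm u) (frame e u i)

/-- The components `F(∂ᵢ, ∂ⱼ) = g(J ∂ᵢ, ∂ⱼ)` of the Kähler form of `(g, J)` in the chart `e`. -/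
def kaehlerIn (g : Metric M) (J : EndoField M) (e : OpenPartialHomeomorph M E4) (u : E4) : Mat :=
  Matrix.of fun i j =>
    g.inner (e.symm u) (J (e.symm u) (frame e u i)) (frame e u j)

/-- `g` is Einstein: `Ric₀ = 0`. -/
def IsEinstein (o : OrientedAtlas M) (g : Metric M) : Prop :=
  ∀ e ∈ o.charts, ∀ u ∈ e.target, ricci₀ (metricIn g e) u = 0

/-- `g` is self-dual: `W⁻ = 0`. -/
def IsSelfDual (o : OrientedAtlas M) (g : Metric M) : Prop :=
  ∀ e ∈ o.charts, ∀ u ∈ e.target, ∀ ψ : Mat, ψ.transpose = -ψ →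
    weylMinus (metricIn g e) u ψ = 0

/-- `J` is a smooth `g`-orthogonal almost-complex structure. -/
structure IsAlmostHermitian (g : Metric M) (J : EndoField M) : Prop where
  smooth : IsSmoothEndo J
  sq : ∀ (x : M) (v : TangentSpace (𝓡 4) x), J x (J x v) = -v
  orthogonal : ∀ (x : M) (v w : TangentSpace (𝓡 4) x), g.inner x (J x v) (J x w) = g.inner x v w

/-- `J` is integrable: its Nijenhuis tensor vanishes. -/
def IsIntegrable (o : OrientedAtlas M) (J : EndoField M) : Prop :=
  ∀ e ∈ o.charts, ∀ u ∈ e.target, ∀ k i j, nijenhuis (endoIn J e) u k i j = 0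

/-- `J` is negative: the Kähler form of `(g, J)` is anti-self-dual. -/
def IsNegative (o : OrientedAtlas M) (g : Metric M) (J : EndoField M) : Prop :=
  ∀ e ∈ o.charts, ∀ u ∈ e.target, IsAntiSelfDualForm (metricIn g e u) (kaehlerIn g J e u)

/-- `(g, I₁, I₂, I₃)` is a negative hyperhermitian structure: the `Iᵢ` are negative `g`-orthogonal
complex structures with `I₁ ∘ I₂ = - I₂ ∘ I₁ = I₃` (here they are `I 0`, `I 1`, `I 2`). -/
structure IsNegativeHyperhermitian (o : OrientedAtlas M) (g : Metric M)
    (I : Fin 3 → EndoField M) : Prop where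
  almostHermitian : ∀ a, IsAlmostHermitian g (I a)
  integrable : ∀ a, IsIntegrable o (I a)
  negative : ∀ a, IsNegative o g (I a)
  mul : ∀ (x : M) (v : TangentSpace (𝓡 4) x), I 0 x (I 1 x v) = I 2 x v
  anticomm : ∀ (x : M) (v : TangentSpace (𝓡 4) x), I 1 x (I 0 x v) = -I 2 x v

/-- `θ` is the Lee form of `(g, J)`: the 1-form with `dF = -2 θ ∧ F`, `F` the Kähler form. -/
structure IsLeeForm (o : OrientedAtlas M) (g : Metric M) (J : EndoField M)
    (θ : CovectorField M) : Prop where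
  smooth : IsSmoothOneForm θ
  lee : ∀ e ∈ o.charts, ∀ u ∈ e.target, ∀ i j k,
    dTwo (kaehlerIn g J e) u i j k = -2 * wedge (covectorIn θ e u) (kaehlerIn g J e u) i j k

end Manifold

end FourDim

end

/-! Work in an oriented chart, with matrices J₁, J₂, J₃ for the triple. Integrability of two members
and the Lee equation of one force DJ₁ = (θ∘J₃) J₂ − (θ∘J₂) J₃ and its cyclic permutations, so that
the triple is parallel for the Weyl connection of θ (`of_integrable`). The Ricci identity for J₁,
traced against J₂, then expresses the curvature on anti-self-dual forms through d(θ∘J₃) +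
(θ∘J₁)∧(θ∘J₂) (`d_connection`). Since g is Einstein with W⁻ = 0, this curvature is s/12 times the
identity (`trace_mul_curvMat`). The skew parts of Dθ∘J₁, Dθ∘J₂, Dθ∘J₃ are therefore known, and they
give Dθ = ½Φ + θ⊗θ + c g with c = ½(s/12 − |θ|²), where Φ commutes with the triple, that is, is
self-dual (`covOne_eq`). Contracting with θ yields the formula for d|θ|².

One more derivative, through the Ricci identity for θ and dΦ = 0, expresses DΦ by the curvature, Φ,
θ and dc (`covForm_dOne_apply`). Each D_XΦ is again self-dual, so its pairing with J₁ vanishes, and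
this determines dc (`differential_eq`). Along θ the curvature term drops out, leaving D_θΦ = 2|θ|²Φ.
Along ψ(θ) it is the curvature on a wedge of θ and ψ(θ), whose self-dual part is a multiple of |θ|²ψ
and produces W⁺(ψ), while the anti-self-dual part sees only s. The same splitting turns the
remaining Φ terms into the commutator [ψ, Φ] (`four_smul_twist`, `weyl_identity`).

The algebra rests on one fact: ℝ⁴ is a quaternionic line, so a self-adjoint endomorphism commuting
with the triple is scalar. -/

namespace FourDim

open Matrix Bundle

/-! ### Linear algebra of a quaternionic triple on ℝ⁴. -/

/-- A positive definite Gram matrix together with a quaternionic triple of endomorphisms which are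
skew for it. -/
structure IsQuaternionic (G J₁ J₂ J₃ : Mat) : Prop where
  symm : Gᵀ = G
  pos : ∀ v : Fin 4 → ℝ, v ≠ 0 → 0 < v ⬝ᵥ G *ᵥ v
  mul₁₁ : J₁ * J₁ = -1
  mul₂₂ : J₂ * J₂ = -1
  mul₃₃ : J₃ * J₃ = -1
  mul₁₂ : J₁ * J₂ = J₃
  mul₂₃ : J₂ * J₃ = J₁
  mul₃₁ : J₃ * J₁ = J₂
  mul₂₁ : J₂ * J₁ = -J₃
  mul₃₂ : J₃ * J₂ = -J₁
  mul₁₃ : J₁ * J₃ = -J₂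
  skew₁ : G * J₁ = -(J₁ᵀ * G)
  skew₂ : G * J₂ = -(J₂ᵀ * G)
  skew₃ : G * J₃ = -(J₃ᵀ * G)

theorem mul_assoc_of_eq {A B C : Mat} (h : A * B = C) (X : Mat) : A * (B * X) = C * X := by
  rw [← mul_assoc, h]

theorem dotProduct_mulVec_skew {G A : Mat} (h : G * A = -(Aᵀ * G))
    (x y : Fin 4 → ℝ) : (A *ᵥ x) ⬝ᵥ G *ᵥ y = -(x ⬝ᵥ G *ᵥ (A *ᵥ y)) := by
  rw [mulVec_mulVec, h, neg_mulVec, dotProduct_neg, neg_neg, ← mulVec_mulVec,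
    dotProduct_mulVec x, vecMul_transpose]

theorem dotProduct_mulVec_comm {G : Mat} (hG : Gᵀ = G) (x y : Fin 4 → ℝ) :
    x ⬝ᵥ G *ᵥ y = y ⬝ᵥ G *ᵥ x := by
  rw [dotProduct_mulVec, ← mulVec_transpose, hG, dotProduct_comm]

theorem dotProduct_mulVec_skew_self {G A : Mat} (hG : Gᵀ = G) (h : G * A = -(Aᵀ * G))
    (x : Fin 4 → ℝ) : x ⬝ᵥ G *ᵥ (A *ᵥ x) = 0 := by
  have h1 := dotProduct_mulVec_skew h x x
  rw [dotProduct_mulVec_comm hG] at h1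
  linarith

namespace IsQuaternionic

variable {G J₁ J₂ J₃ : Mat}

theorem rotate (Q : IsQuaternionic G J₁ J₂ J₃) : IsQuaternionic G J₂ J₃ J₁ :=
  ⟨Q.symm, Q.pos, Q.mul₂₂, Q.mul₃₃, Q.mul₁₁, Q.mul₂₃, Q.mul₃₁, Q.mul₁₂, Q.mul₃₂, Q.mul₁₃, Q.mul₂₁,
    Q.skew₂, Q.skew₃, Q.skew₁⟩

theorem det_ne_zero (Q : IsQuaternionic G J₁ J₂ J₃) : G.det ≠ 0 := by
  intro h
  obtain ⟨v, hv, h0⟩ := exists_mulVec_eq_zero_iff.2 h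
  have := Q.pos v hv
  simp [h0] at this

/-- A nonzero vector and its images under the triple form an orthogonal basis. -/
theorem expansion (Q : IsQuaternionic G J₁ J₂ J₃) {v : Fin 4 → ℝ} (hv : v ≠ 0) (w : Fin 4 → ℝ) :
    (v ⬝ᵥ G *ᵥ v) • w = (v ⬝ᵥ G *ᵥ w) • v + ((J₁ *ᵥ v) ⬝ᵥ G *ᵥ w) • (J₁ *ᵥ v)
      + ((J₂ *ᵥ v) ⬝ᵥ G *ᵥ w) • (J₂ *ᵥ v) + ((J₃ *ᵥ v) ⬝ᵥ G *ᵥ w) • (J₃ *ᵥ v) := by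
  set n := v ⬝ᵥ G *ᵥ v with hn
  have hn0 : n ≠ 0 := (Q.pos v hv).ne'
  let p : Fin 4 → Fin 4 → ℝ := ![v, J₁ *ᵥ v, J₂ *ᵥ v, J₃ *ᵥ v]
  have s := fun x y => dotProduct_mulVec_skew Q.skew₁ x y
  have s₂ := fun x y => dotProduct_mulVec_skew Q.skew₂ x y
  have s₃ := fun x y => dotProduct_mulVec_skew Q.skew₃ x y
  have z := dotProduct_mulVec_skew_self Q.symm Q.skew₁ v
  have z₂ := dotProduct_mulVec_skew_self Q.symm Q.skew₂ v
  have z₃ := dotProduct_mulVec_skew_self Q.symm Q.skew₃ v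
  have key : ∀ i j, p i ⬝ᵥ G *ᵥ p j = if i = j then n else 0 := by
    have m : ∀ {A B C : Mat}, A * B = C → A *ᵥ (B *ᵥ v) = C *ᵥ v := by
      rintro A B C rfl; exact mulVec_mulVec _ _ _
    intro i j
    fin_cases i <;> fin_cases j <;>
      simp [p, s, s₂, s₃, z, z₂, z₃, hn, m Q.mul₁₁, m Q.mul₂₂, m Q.mul₃₃, m Q.mul₁₂, m Q.mul₂₃,
        m Q.mul₃₁,
        m Q.mul₂₁, m Q.mul₃₂, m Q.mul₁₃, neg_mulVec, mulVec_neg, -mulVec_mulVec]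
  -- By `key`, P G Pᵀ = n; since one-sided inverses of square matrices are two-sided, Pᵀ P G = n,
  -- which is the expansion.
  let P : Mat := Matrix.of p
  have h1 : P * (G * Pᵀ) = n • (1 : Mat) := by
    ext i j
    have h2 : (P * (G * Pᵀ)) i j = p i ⬝ᵥ G *ᵥ p j := rfl
    rw [h2, key i j, Matrix.smul_apply, one_apply, smul_eq_mul, mul_ite, mul_one, mul_zero]
  have h2 : (G * Pᵀ) * P = n • (1 : Mat) := by
    have h3 : P * ((n⁻¹ • (G * Pᵀ))) = 1 := by
      rw [Matrix.mul_smul, h1, smul_smul, inv_mul_cancel₀ hn0, one_smul]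
    have h4 := mul_eq_one_comm.1 h3
    rw [Matrix.smul_mul] at h4
    rw [← h4, smul_smul, mul_inv_cancel₀ hn0, one_smul]
  have h5 : Pᵀ * (P * G) = n • (1 : Mat) := by
    have := congrArg transpose h2
    rw [transpose_mul, transpose_mul, transpose_transpose, Q.symm] at this
    rw [this, transpose_smul, transpose_one]
  have h6 : n • w = (Pᵀ * (P * G)) *ᵥ w := by
    rw [h5, smul_mulVec, one_mulVec]
  rw [h6, ← mulVec_mulVec, ← mulVec_mulVec]
  ext i
  simp only [mulVec, dotProduct, Fin.sum_univ_four, P, p, transpose_apply, of_apply, Pi.add_apply,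
    Pi.smul_apply, smul_eq_mul, cons_val_zero, cons_val_one, cons_val]
  ring

/-- A self-adjoint endomorphism commuting with the triple is a multiple of the identity. -/
theorem eq_smul_one (Q : IsQuaternionic G J₁ J₂ J₃) {A : Mat} (hA : G * A = Aᵀ * G)
    (h₁ : A * J₁ = J₁ * A) (h₂ : A * J₂ = J₂ * A) (h₃ : A * J₃ = J₃ * A) :
    ∃ c : ℝ, A = c • (1 : Mat) := by
  obtain ⟨v, hv⟩ : ∃ v : Fin 4 → ℝ, v ≠ 0 := ⟨fun _ => 1, fun h => by simpa using congrFun h 0⟩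
  have hn := (Q.pos v hv).ne'
  -- A self-adjoint and J skew commute, so AJ is skew and Av is orthogonal to Jv; hence Av is a
  -- multiple of v.
  have z : ∀ {J : Mat}, G * J = -(Jᵀ * G) → A * J = J * A → (J *ᵥ v) ⬝ᵥ G *ᵥ (A *ᵥ v) = 0 := by
    intro J hJ hc
    have h2 : (J *ᵥ v) ⬝ᵥ G *ᵥ (A *ᵥ v) = -((A *ᵥ v) ⬝ᵥ G *ᵥ (J *ᵥ v)) := by
      rw [mulVec_mulVec v G A, hA, ← mulVec_mulVec, dotProduct_mulVec _ Aᵀ, vecMul_transpose,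
        mulVec_mulVec, hc, ← mulVec_mulVec, dotProduct_mulVec_skew hJ]
    rw [dotProduct_mulVec_comm Q.symm (A *ᵥ v)] at h2
    linarith
  refine ⟨(v ⬝ᵥ G *ᵥ (A *ᵥ v)) / (v ⬝ᵥ G *ᵥ v), ?_⟩
  set c := (v ⬝ᵥ G *ᵥ (A *ᵥ v)) / (v ⬝ᵥ G *ᵥ v) with hc
  have hAv : A *ᵥ v = c • v := by
    have h1 := Q.expansion hv (A *ᵥ v)
    rw [z Q.skew₁ h₁, z Q.skew₂ h₂, z Q.skew₃ h₃] at h1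
    simp only [zero_smul, add_zero] at h1
    rw [hc, div_eq_inv_mul, ← smul_smul, ← h1, smul_smul, inv_mul_cancel₀ hn, one_smul]
  have hAJ : ∀ {J : Mat}, A * J = J * A → A *ᵥ (J *ᵥ v) = c • (J *ᵥ v) := by
    intro J hJ
    rw [mulVec_mulVec, hJ, ← mulVec_mulVec, hAv, mulVec_smul]
  have hw : ∀ w, A *ᵥ w = c • w := by
    intro w
    have h1 := congrArg (fun x => A *ᵥ x) (Q.expansion hv w)
    simp only [mulVec_smul, mulVec_add, hAv, hAJ h₁, hAJ h₂, hAJ h₃] at h1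
    have h2 : (v ⬝ᵥ G *ᵥ v) • (A *ᵥ w) = (v ⬝ᵥ G *ᵥ v) • (c • w) := by
      rw [h1, smul_comm _ c w, Q.expansion hv w]
      module
    exact smul_right_injective _ hn h2
  apply Matrix.ext_of_mulVec_single
  intro i
  rw [hw, smul_mulVec, one_mulVec]

/-- The left side is, up to a factor, the average of N over the quaternion group, so it commutes
with the triple. It is still self-adjoint, hence scalar by `eq_smul_one`; each J N J has trace −tr
N, which fixes the scalar. -/
theorem sub_conj_eq_trace (Q : IsQuaternionic G J₁ J₂ J₃) {N : Mat} (hN : G * N = Nᵀ * G) :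
    N - J₁ * N * J₁ - J₂ * N * J₂ - J₃ * N * J₃ = N.trace • (1 : Mat) := by
  obtain ⟨B, hB⟩ : ∃ B, B = N - J₁ * N * J₁ - J₂ * N * J₂ - J₃ * N * J₃ := ⟨_, rfl⟩
  rw [← hB]
  have hs : ∀ {J : Mat}, G * J = -(Jᵀ * G) → G * (J * N * J) = (J * N * J)ᵀ * G := by
    intro J hJ
    rw [mul_assoc J, mul_assoc_of_eq hJ, neg_mul, mul_assoc Jᵀ, ← mul_assoc G N, hN, mul_assoc Nᵀ,
      hJ, transpose_mul, transpose_mul]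
    simp only [mul_neg, neg_neg, mul_assoc]
  have hsB : G * B = Bᵀ * G := by
    simp only [hB, mul_sub, transpose_sub, sub_mul, hN, hs Q.skew₁, hs Q.skew₂, hs Q.skew₃]
  obtain ⟨c, hc⟩ := Q.eq_smul_one (A := B) hsB
    (by simp only [hB, mul_sub, sub_mul, mul_assoc, Q.mul₁₁, Q.mul₂₁, Q.mul₃₁,
          mul_assoc_of_eq Q.mul₁₁, mul_assoc_of_eq Q.mul₁₂, mul_assoc_of_eq Q.mul₁₃]
        noncomm_ring)
    (by simp only [hB, mul_sub, sub_mul, mul_assoc, Q.mul₁₂, Q.mul₂₂, Q.mul₃₂,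
          mul_assoc_of_eq Q.mul₂₁, mul_assoc_of_eq Q.mul₂₂, mul_assoc_of_eq Q.mul₂₃]
        noncomm_ring)
    (by simp only [hB, mul_sub, sub_mul, mul_assoc, Q.mul₁₃, Q.mul₂₃, Q.mul₃₃,
          mul_assoc_of_eq Q.mul₃₁, mul_assoc_of_eq Q.mul₃₂, mul_assoc_of_eq Q.mul₃₃]
        noncomm_ring)
  have ht : ∀ {J : Mat}, J * J = -1 → (J * N * J).trace = -N.trace := by
    intro J hJ
    rw [trace_mul_comm, ← mul_assoc, hJ, neg_one_mul, trace_neg]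
  have h1 := congrArg trace hB
  rw [trace_sub, trace_sub, trace_sub, ht Q.mul₁₁, ht Q.mul₂₂, ht Q.mul₃₃] at h1
  have h2 := congrArg trace hc
  rw [h1, trace_smul, trace_one] at h2
  rw [hc]
  congr 1
  simp at h2
  linarith

/-- The part of a skew endomorphism which does not commute with the triple lies in its span. -/
theorem skew_decomp (Q : IsQuaternionic G J₁ J₂ J₃) {A : Mat} (hA : G * A = -(Aᵀ * G)) :
    (3 : ℝ) • A + J₁ * A * J₁ + J₂ * A * J₂ + J₃ * A * J₃ =
      -((A * J₁).trace • J₁ + (A * J₂).trace • J₂ + (A * J₃).trace • J₃) := by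
  -- For A and J skew the anticommutator AJ + JA is self-adjoint, so the averaging identity applies
  -- to it.
  have key : ∀ {J : Mat}, G * J = -(Jᵀ * G) →
      A * J + J * A - J₁ * (A * J + J * A) * J₁ - J₂ * (A * J + J * A) * J₂
        - J₃ * (A * J + J * A) * J₃ = (2 * (A * J).trace) • (1 : Mat) := by
    intro J hJ
    rw [Q.sub_conj_eq_trace, trace_add, trace_mul_comm J A, two_mul]
    rw [mul_add, mul_assoc_of_eq hA, mul_assoc_of_eq hJ, transpose_add, transpose_mul,
      transpose_mul, add_mul, neg_mul, neg_mul, mul_assoc, mul_assoc, mul_assoc, mul_assoc, hA, hJ]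
    simp only [mul_neg, neg_neg, add_comm]
  have k₁ := congrArg (· * J₁) (key Q.skew₁)
  have k₂ := congrArg (· * J₂) (key Q.skew₂)
  have k₃ := congrArg (· * J₃) (key Q.skew₃)
  simp only [mul_add, add_mul, sub_mul, mul_assoc, Q.mul₁₁, Q.mul₂₂, Q.mul₃₃, Q.mul₁₂, Q.mul₂₃,
    Q.mul₃₁, Q.mul₂₁, Q.mul₃₂, Q.mul₁₃, mul_assoc_of_eq Q.mul₁₁, mul_assoc_of_eq Q.mul₂₂,
    mul_assoc_of_eq Q.mul₃₃, mul_assoc_of_eq Q.mul₁₂, mul_assoc_of_eq Q.mul₂₃,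
    mul_assoc_of_eq Q.mul₃₁, mul_assoc_of_eq Q.mul₂₁, mul_assoc_of_eq Q.mul₃₂,
    mul_assoc_of_eq Q.mul₁₃, mul_neg, neg_mul, mul_one, one_mul, smul_mul_assoc, neg_neg,
    mul_smul] at k₁ k₂ k₃ ⊢
  -- Multiplying the three averaged anticommutators by J₁, J₂, J₃ and adding gives twice the claim.
  have e : (2 : ℝ) • ((A * J₁).trace • J₁ + (A * J₂).trace • J₂ + (A * J₃).trace • J₃) =
      (2 : ℝ) • (-((3 : ℝ) • A + J₁ * (A * J₁) + J₂ * (A * J₂) + J₃ * (A * J₃))) := by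
    rw [smul_add, smul_add, ← k₁, ← k₂, ← k₃]
    module
  have := smul_right_injective Mat (two_ne_zero (α := ℝ)) e
  rw [this, neg_neg]

/-- Write J₁ = J₂J₃, move J₂ through A and around the trace: J₃J₂ = −J₁ reverses the sign. This is
how self-dual endomorphisms are seen to be orthogonal to the triple. -/
theorem trace_mul_eq_zero (Q : IsQuaternionic G J₁ J₂ J₃) {A : Mat} (h₂ : A * J₂ = J₂ * A) :
    (A * J₁).trace = 0 := by
  have h : (A * J₁).trace = -(A * J₁).trace := by
    conv_lhs => rw [← Q.mul₂₃, ← mul_assoc, h₂, mul_assoc, trace_mul_comm, mul_assoc, Q.mul₃₂]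
    simp
  linarith

/-- A skew endomorphism anticommuting with `J₁` lies in the span of `J₂` and `J₃`. -/
theorem eq_of_anticommute (Q : IsQuaternionic G J₁ J₂ J₃) {A : Mat} (hA : G * A = -(Aᵀ * G))
    (h₁ : A * J₁ = -(J₁ * A)) :
    A = (-(A * J₂).trace / 4) • J₂ + (-(A * J₃).trace / 4) • J₃ := by
  have h := Q.skew_decomp hA
  have e₁ : J₁ * A * J₁ = A := by
    rw [mul_assoc, h₁, mul_neg, mul_assoc_of_eq Q.mul₁₁]; simp
  -- With J₃ = J₁J₂ and A anticommuting with J₁, the J₂ and J₃ terms of `skew_decomp` cancel, which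
  -- leaves 4A.
  have e₃ : J₃ * A * J₃ = -(J₂ * A * J₂) := by
    conv_lhs => rw [← Q.mul₁₂]
    rw [mul_assoc, mul_assoc, ← mul_assoc A J₁, h₁]
    simp only [neg_mul, mul_neg, mul_assoc, mul_assoc_of_eq Q.mul₂₁]
    rw [← Q.mul₁₂]
    simp only [neg_mul, neg_neg, mul_assoc, mul_assoc_of_eq Q.mul₁₁, one_mul]
  have t₁ : (A * J₁).trace = 0 := by
    have : (A * J₁).trace = -(A * J₁).trace := by
      conv_lhs => rw [h₁, trace_neg, trace_mul_comm]
    linarith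
  rw [e₁, e₃, t₁, zero_smul, zero_add, add_neg_cancel_right] at h
  have h4 : (4 : ℝ) • A = -((A * J₂).trace • J₂ + (A * J₃).trace • J₃) := by
    rw [← h]; module
  calc A = (4⁻¹ : ℝ) • ((4 : ℝ) • A) := by module
    _ = _ := by rw [h4]; module

end IsQuaternionic

/-! ### Partial derivatives of functions and of matrix-valued functions. -/

section Calculus

variable {U : Set E4} {f h : E4 → ℝ} {u : E4}

theorem differentiableAt_of_contDiffOn (hU : IsOpen U) (hf : ContDiffOn ℝ ∞ f U) (hu : u ∈ U) :
    DifferentiableAt ℝ f u :=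
  (hf.contDiffAt (hU.mem_nhds hu)).differentiableAt (by simp)

theorem contDiffOn_pd (hU : IsOpen U) (hf : ContDiffOn ℝ ∞ f U) (i : Fin 4) :
    ContDiffOn ℝ ∞ (pd i f) U :=
  (hf.fderiv_of_isOpen hU (m := ∞) (by simp)).clm_apply contDiffOn_const

theorem pd_congr (hU : IsOpen U) (hu : u ∈ U) (h' : ∀ v ∈ U, f v = h v) (i : Fin 4) :
    pd i f u = pd i h u := by
  have : f =ᶠ[nhds u] h := Filter.eventuallyEq_of_mem (hU.mem_nhds hu) h'
  rw [pd, pd, this.fderiv_eq]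

theorem pd_const (c : ℝ) (i : Fin 4) : pd i (fun _ => c) u = 0 := by simp [pd]

theorem pd_add (hf : DifferentiableAt ℝ f u) (hh : DifferentiableAt ℝ h u) (i : Fin 4) :
    pd i (fun v => f v + h v) u = pd i f u + pd i h u := by
  simp [pd, fderiv_fun_add hf hh]

theorem pd_sub (hf : DifferentiableAt ℝ f u) (hh : DifferentiableAt ℝ h u) (i : Fin 4) :
    pd i (fun v => f v - h v) u = pd i f u - pd i h u := by
  simp [pd, fderiv_fun_sub hf hh]

theorem pd_neg (i : Fin 4) : pd i (fun v => -f v) u = -pd i f u := by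
  simp [pd, fderiv_fun_neg]

theorem pd_mul (hf : DifferentiableAt ℝ f u) (hh : DifferentiableAt ℝ h u) (i : Fin 4) :
    pd i (fun v => f v * h v) u = pd i f u * h u + f u * pd i h u := by
  simp [pd, fderiv_fun_mul hf hh]; ring

theorem pd_sum {ι : Type*} {s : Finset ι} {F : ι → E4 → ℝ}
    (hF : ∀ k ∈ s, DifferentiableAt ℝ (F k) u) (i : Fin 4) :
    pd i (fun v => ∑ k ∈ s, F k v) u = ∑ k ∈ s, pd i (F k) u := by
  simp [pd, fderiv_fun_sum hF]

theorem pd_comm (hU : IsOpen U) (hf : ContDiffOn ℝ ∞ f U) (hu : u ∈ U) (i j : Fin 4) :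
    pd i (pd j f) u = pd j (pd i f) u := by
  have hfu := hf.contDiffAt (hU.mem_nhds hu)
  have hs : IsSymmSndFDerivAt ℝ f u := hfu.isSymmSndFDerivAt (by
    simp only [minSmoothness_of_isRCLikeNormedField]
    exact WithTop.coe_le_coe.2 le_top)
  have hd : DifferentiableAt ℝ (fderiv ℝ f) u :=
    (hfu.fderiv_right (m := 1) (by exact WithTop.coe_le_coe.2 le_top)).differentiableAt (by simp)
  have e : ∀ a b : Fin 4, pd a (pd b f) u =
      fderiv ℝ (fderiv ℝ f) u (EuclideanSpace.single a 1) (EuclideanSpace.single b 1) := by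
    intro a b
    change fderiv ℝ (fun v => fderiv ℝ f v (EuclideanSpace.single b 1)) u _ = _
    rw [fderiv_clm_apply hd (by fun_prop)]
    simp
  rw [e, e, hs.eq]

end Calculus

/-- Smoothness of a matrix-valued function on `U`. -/
def SmoothMat (U : Set E4) (A : E4 → Mat) : Prop :=
  ∀ k l, ContDiffOn ℝ ∞ (fun u => A u k l) U

/-- The entrywise partial derivative of a matrix-valued function. -/
noncomputable def pdMat (i : Fin 4) (A : E4 → Mat) (u : E4) : Mat :=
  Matrix.of fun k l => pd i (fun v => A v k l) u

section MatrixCalculus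

variable {U : Set E4} {A B : E4 → Mat} {u : E4}

theorem SmoothMat.diffAt (hU : IsOpen U) (hA : SmoothMat U A) (hu : u ∈ U) (k l : Fin 4) :
    DifferentiableAt ℝ (fun u => A u k l) u :=
  differentiableAt_of_contDiffOn hU (hA k l) hu

theorem SmoothMat.mul (hA : SmoothMat U A) (hB : SmoothMat U B) :
    SmoothMat U (fun u => A u * B u) := by
  intro k l
  simp only [Matrix.mul_apply]
  exact ContDiffOn.sum fun m _ => (hA k m).mul (hB m l)

theorem SmoothMat.add (hA : SmoothMat U A) (hB : SmoothMat U B) :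
    SmoothMat U (fun u => A u + B u) := fun k l => (hA k l).add (hB k l)

theorem SmoothMat.sub (hA : SmoothMat U A) (hB : SmoothMat U B) :
    SmoothMat U (fun u => A u - B u) := fun k l => (hA k l).sub (hB k l)

theorem SmoothMat.transpose (hA : SmoothMat U A) : SmoothMat U (fun u => (A u)ᵀ) :=
  fun k l => hA l k

theorem SmoothMat.smul {f : E4 → ℝ} (hf : ContDiffOn ℝ ∞ f U) (hA : SmoothMat U A) :
    SmoothMat U (fun u => f u • A u) := fun k l => hf.mul (hA k l)

theorem SmoothMat.congr (hA : SmoothMat U A) (h : ∀ v ∈ U, B v = A v) : SmoothMat U B :=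
  fun k l => (hA k l).congr fun v hv => by rw [h v hv]

theorem SmoothMat.pdMat (hU : IsOpen U) (hA : SmoothMat U A) (i : Fin 4) :
    SmoothMat U (pdMat i A) := fun k l => contDiffOn_pd hU (hA k l) i

theorem SmoothMat.det (hA : SmoothMat U A) : ContDiffOn ℝ ∞ (fun u => (A u).det) U := by
  simp only [Matrix.det_apply']
  exact ContDiffOn.sum fun σ _ => contDiffOn_const.mul (contDiffOn_prod fun i _ => hA _ _)

theorem SmoothMat.inv (hA : SmoothMat U A) (h : ∀ u ∈ U, (A u).det ≠ 0) :
    SmoothMat U (fun u => (A u)⁻¹) := by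
  intro k l
  simp only [Matrix.inv_def, Matrix.smul_apply, smul_eq_mul, Ring.inverse_eq_inv']
  refine (hA.det.inv h).mul ?_
  simp only [adjugate_apply]
  refine SmoothMat.det (A := fun u => (A u).updateRow l (Pi.single k 1)) fun i j => ?_
  simp only [updateRow_apply]
  split_ifs
  · exact contDiffOn_const
  · exact hA i j

theorem pdMat_congr (hU : IsOpen U) (hu : u ∈ U) (h : ∀ v ∈ U, A v = B v) (i : Fin 4) :
    pdMat i A u = pdMat i B u := by
  ext k l
  exact pd_congr hU hu (fun v hv => by rw [h v hv]) i

theorem pdMat_const (C : Mat) (i : Fin 4) : pdMat i (fun _ => C) u = 0 := by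
  ext k l
  exact pd_const _ i

theorem pdMat_mul (hU : IsOpen U) (hu : u ∈ U) (hA : SmoothMat U A) (hB : SmoothMat U B)
    (i : Fin 4) : pdMat i (fun v => A v * B v) u = pdMat i A u * B u + A u * pdMat i B u := by
  ext k l
  simp only [pdMat, of_apply, Matrix.mul_apply, Matrix.add_apply]
  rw [pd_sum (F := fun m v => A v k m * B v m l)
    fun m _ => (hA.diffAt hU hu k m).mul (hB.diffAt hU hu m l), ← Finset.sum_add_distrib]
  exact Finset.sum_congr rfl fun m _ => pd_mul (hA.diffAt hU hu k m) (hB.diffAt hU hu m l) i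

theorem pdMat_add (hU : IsOpen U) (hu : u ∈ U) (hA : SmoothMat U A) (hB : SmoothMat U B)
    (i : Fin 4) : pdMat i (fun v => A v + B v) u = pdMat i A u + pdMat i B u := by
  ext k l
  exact pd_add (hA.diffAt hU hu k l) (hB.diffAt hU hu k l) i

theorem pdMat_sub (hU : IsOpen U) (hu : u ∈ U) (hA : SmoothMat U A) (hB : SmoothMat U B)
    (i : Fin 4) : pdMat i (fun v => A v - B v) u = pdMat i A u - pdMat i B u := by
  ext k l
  exact pd_sub (hA.diffAt hU hu k l) (hB.diffAt hU hu k l) i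

theorem pdMat_neg (i : Fin 4) : pdMat i (fun v => -A v) u = -pdMat i A u := by
  ext k l
  exact pd_neg i

theorem pdMat_transpose (i : Fin 4) : pdMat i (fun v => (A v)ᵀ) u = (pdMat i A u)ᵀ := rfl

theorem pdMat_smul {f : E4 → ℝ} (hU : IsOpen U) (hu : u ∈ U) (hf : ContDiffOn ℝ ∞ f U)
    (hA : SmoothMat U A) (i : Fin 4) :
    pdMat i (fun v => f v • A v) u = pd i f u • A u + f u • pdMat i A u := by
  ext k l
  exact pd_mul (differentiableAt_of_contDiffOn hU hf hu) (hA.diffAt hU hu k l) i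

theorem pdMat_comm (hU : IsOpen U) (hu : u ∈ U) (hA : SmoothMat U A) (i j : Fin 4) :
    pdMat i (pdMat j A) u = pdMat j (pdMat i A) u := by
  ext k l
  exact pd_comm hU (hA k l) hu i j

end MatrixCalculus

/-! ### The Levi-Civita connection and its curvature in matrix form. -/

/-- The metric `G` is smooth, symmetric and nondegenerate on the open set `U`. -/
structure IsLocalMetric (U : Set E4) (G : E4 → Mat) : Prop where
  isOpen : IsOpen U
  smooth : SmoothMat U G
  symm : ∀ u ∈ U, (G u)ᵀ = G u
  det_ne_zero : ∀ u ∈ U, (G u).det ≠ 0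

/-- The connection matrices `(Γᵢ) k j = Γᵏᵢⱼ`. -/
noncomputable def connMat (G : E4 → Mat) (i : Fin 4) (u : E4) : Mat :=
  Matrix.of fun k j => christoffel G u k i j

/-- The curvature matrices `∂ᵢΓⱼ - ∂ⱼΓᵢ + [Γᵢ, Γⱼ]`. -/
noncomputable def curvMat (G : E4 → Mat) (i j : Fin 4) (u : E4) : Mat :=
  pdMat i (connMat G j) u - pdMat j (connMat G i) u + connMat G i u * connMat G j u
    - connMat G j u * connMat G i u

/-- The covariant derivative along `∂ᵢ` of a field of endomorphisms. -/
noncomputable def covEndo (G : E4 → Mat) (i : Fin 4) (A : E4 → Mat) (u : E4) : Mat :=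
  pdMat i A u + connMat G i u * A u - A u * connMat G i u

/-- The covariant derivative along `∂ᵢ` of a family of covectors, the rows of the matrix. -/
noncomputable def covRow (G : E4 → Mat) (i : Fin 4) (A : E4 → Mat) (u : E4) : Mat :=
  pdMat i A u - A u * connMat G i u

/-- The covariant derivative along `∂ᵢ` of a bilinear form. -/
noncomputable def covForm (G : E4 → Mat) (i : Fin 4) (A : E4 → Mat) (u : E4) : Mat :=
  pdMat i A u - (connMat G i u)ᵀ * A u - A u * connMat G i u

theorem riemann_eq_curvMat (G : E4 → Mat) (u : E4) (i j k l : Fin 4) :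
    riemann G u i j k l = -curvMat G i j u l k := by
  simp only [riemann, curvMat, Matrix.sub_apply, Matrix.add_apply, Matrix.mul_apply, pdMat,
    connMat, of_apply, Finset.sum_sub_distrib]
  ring

theorem covDeriv_eq_sum (G : E4 → Mat) (ψ : E4 → Mat) (u : E4) (X : Fin 4 → ℝ) :
    covDeriv G ψ u X = ∑ a, X a • covForm G a ψ u := by
  ext i j
  simp only [covDeriv, of_apply, Matrix.sum_apply, Matrix.smul_apply, covForm, Matrix.sub_apply,
    Matrix.mul_apply, pdMat, connMat, transpose_apply, smul_eq_mul, Finset.sum_add_distrib]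
  refine Finset.sum_congr rfl fun a _ => ?_
  congr 1
  rw [sub_sub]
  congr 2
  exact Finset.sum_congr rfl fun m _ => mul_comm _ _

namespace IsLocalMetric

variable {U : Set E4} {G : E4 → Mat} {u : E4}

theorem inv_mul (hG : IsLocalMetric U G) (hu : u ∈ U) : (G u)⁻¹ * G u = 1 :=
  nonsing_inv_mul _ (isUnit_iff_ne_zero.2 (hG.det_ne_zero u hu))

theorem mul_inv (hG : IsLocalMetric U G) (hu : u ∈ U) : G u * (G u)⁻¹ = 1 :=
  mul_nonsing_inv _ (isUnit_iff_ne_zero.2 (hG.det_ne_zero u hu))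

theorem smooth_inv (hG : IsLocalMetric U G) : SmoothMat U (fun u => (G u)⁻¹) :=
  hG.smooth.inv hG.det_ne_zero

theorem smooth_connMat (hG : IsLocalMetric U G) (i : Fin 4) : SmoothMat U (connMat G i) := by
  intro k j
  simp only [connMat, of_apply, christoffel]
  refine contDiffOn_const.mul (ContDiffOn.sum fun l _ => (hG.smooth_inv k l).mul ?_)
  exact ((contDiffOn_pd hG.isOpen (hG.smooth j l) i).add
    (contDiffOn_pd hG.isOpen (hG.smooth i l) j)).sub (contDiffOn_pd hG.isOpen (hG.smooth i j) l)

theorem smooth_curvMat (hG : IsLocalMetric U G) (i j : Fin 4) : SmoothMat U (curvMat G i j) :=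
  (((((hG.smooth_connMat j).pdMat hG.isOpen i).sub ((hG.smooth_connMat i).pdMat hG.isOpen j)).add
    ((hG.smooth_connMat i).mul (hG.smooth_connMat j)))).sub
    ((hG.smooth_connMat j).mul (hG.smooth_connMat i))

theorem pd_symm (hG : IsLocalMetric U G) (hu : u ∈ U) (i k l : Fin 4) :
    pd i (fun v => G v k l) u = pd i (fun v => G v l k) u :=
  pd_congr hG.isOpen hu (fun v hv => by rw [← hG.symm v hv, transpose_apply, hG.symm v hv]) i

theorem connMat_symm (hG : IsLocalMetric U G) (hu : u ∈ U) (i j k : Fin 4) :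
    connMat G i u k j = connMat G j u k i := by
  simp only [connMat, of_apply, christoffel]
  congr 1
  refine Finset.sum_congr rfl fun l _ => ?_
  rw [hG.pd_symm hu l i j]
  ring

theorem mul_connMat (hG : IsLocalMetric U G) (hu : u ∈ U) (i j l : Fin 4) :
    (G u * connMat G i u) l j = (1 / 2) * (pd i (fun v => G v j l) u + pd j (fun v => G v i l) u
      - pd l (fun v => G v i j) u) := by
  let w : Fin 4 → ℝ := fun l => (1 / 2) * (pd i (fun v => G v j l) u + pd j (fun v => G v i l) u
      - pd l (fun v => G v i j) u)
  have h : ∀ k, connMat G i u k j = ((G u)⁻¹ *ᵥ w) k := by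
    intro k
    simp only [connMat, of_apply, christoffel, mulVec, dotProduct, w, Finset.mul_sum]
    exact Finset.sum_congr rfl fun m _ => by ring
  have h2 : (G u * connMat G i u) l j = (G u *ᵥ ((G u)⁻¹ *ᵥ w)) l := by
    simp only [Matrix.mul_apply, h, mulVec, dotProduct]
  rw [h2, mulVec_mulVec, hG.mul_inv hu, one_mulVec]

/-- The Levi-Civita connection preserves the metric. -/
theorem pdMat_metric (hG : IsLocalMetric U G) (hu : u ∈ U) (i : Fin 4) :
    pdMat i G u = (connMat G i u)ᵀ * G u + G u * connMat G i u := by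
  ext k l
  have h : ((connMat G i u)ᵀ * G u) k l = (G u * connMat G i u) l k := by
    conv_rhs => rw [← hG.symm u hu, ← transpose_transpose (connMat G i u), ← transpose_mul,
      transpose_apply]
  rw [Matrix.add_apply, h, hG.mul_connMat hu, hG.mul_connMat hu, pdMat, of_apply,
    hG.pd_symm hu i l k, hG.pd_symm hu k i l, hG.pd_symm hu l i k]
  have := hG.pd_symm hu k l i
  have := hG.pd_symm hu l k i
  linarith

theorem pdMat_inv (hG : IsLocalMetric U G) (hu : u ∈ U) (i : Fin 4) :
    pdMat i (fun v => (G v)⁻¹) u = -(connMat G i u * (G u)⁻¹) - (G u)⁻¹ * (connMat G i u)ᵀ := by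
  have h : pdMat i (fun v => (G v)⁻¹ * G v) u = 0 := by
    rw [pdMat_congr hG.isOpen hu (fun v hv => hG.inv_mul hv), pdMat_const]
  rw [pdMat_mul hG.isOpen hu hG.smooth_inv hG.smooth, hG.pdMat_metric hu] at h
  have h2 := congrArg (· * (G u)⁻¹) h
  simp only [add_mul, mul_assoc, hG.mul_inv hu, mul_one, zero_mul, mul_add] at h2
  rw [← mul_assoc (G u)⁻¹ (G u), hG.inv_mul hu, one_mul] at h2
  rw [eq_neg_of_add_eq_zero_left h2]
  abel

theorem curvMat_swap (i j : Fin 4) : curvMat G j i u = -curvMat G i j u := by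
  simp only [curvMat]; abel

/-- Differentiate ∂G = ΓᵀG + GΓ once more: symmetry of second derivatives leaves exactly the
skewness of the curvature. -/
theorem curvMat_skew (hG : IsLocalMetric U G) (hu : u ∈ U) (i j : Fin 4) :
    G u * curvMat G i j u = -((curvMat G i j u)ᵀ * G u) := by
  have e : ∀ a b, pdMat a (pdMat b G) u =
      ((pdMat a (connMat G b) u)ᵀ * G u
        + (connMat G b u)ᵀ * ((connMat G a u)ᵀ * G u + G u * connMat G a u))
      + (((connMat G a u)ᵀ * G u + G u * connMat G a u) * connMat G b u
        + G u * pdMat a (connMat G b) u) := by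
    intro a b
    have hb := hG.smooth_connMat b
    rw [pdMat_congr hG.isOpen hu (fun v hv => hG.pdMat_metric hv b),
      pdMat_add hG.isOpen hu (hb.transpose.mul hG.smooth) (hG.smooth.mul hb),
      pdMat_mul hG.isOpen hu hb.transpose hG.smooth, pdMat_mul hG.isOpen hu hG.smooth hb,
      hG.pdMat_metric hu, pdMat_transpose]
  have h := pdMat_comm hG.isOpen hu hG.smooth i j
  rw [e, e] at h
  rw [← sub_eq_zero] at h
  rw [← sub_eq_zero, ← h]
  simp only [curvMat, transpose_sub, transpose_add, transpose_mul]
  noncomm_ring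

/-- Two signs cancel: `riemann` is opposite to `curvMat`, and moving the metric across a skew
endomorphism costs another sign. -/
theorem riemannLow_eq (hG : IsLocalMetric U G) (hu : u ∈ U) (i j k l : Fin 4) :
    riemannLow G u i j k l = (G u * curvMat G i j u) k l := by
  rw [hG.curvMat_skew hu, Matrix.neg_apply, Matrix.mul_apply, riemannLow, ← Finset.sum_neg_distrib]
  exact Finset.sum_congr rfl fun m _ => by rw [riemann_eq_curvMat, transpose_apply, neg_mul]

theorem curvMat_bianchi (hG : IsLocalMetric U G) (hu : u ∈ U) (i j k l : Fin 4) :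
    curvMat G i j u l k + curvMat G j k u l i + curvMat G k i u l j = 0 := by
  have e : ∀ a b c, pdMat a (connMat G b) u l c = pdMat a (connMat G c) u l b := fun a b c =>
    pd_congr hG.isOpen hu (fun v hv => hG.connMat_symm hv b c l) a
  have p : ∀ a b c, (connMat G a u * connMat G b u) l c = (connMat G a u * connMat G c u) l b := by
    intro a b c
    simp only [Matrix.mul_apply]
    exact Finset.sum_congr rfl fun m _ => by rw [hG.connMat_symm hu b c m]
  simp only [curvMat, Matrix.sub_apply, Matrix.add_apply]
  rw [e i j k, e j i k, e k j i, p i j k, p j i k, p k j i]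
  ring

theorem riemannLow_swap (hG : IsLocalMetric U G) (hu : u ∈ U) (i j k l : Fin 4) :
    riemannLow G u j i k l = -riemannLow G u i j k l := by
  rw [hG.riemannLow_eq hu, hG.riemannLow_eq hu, curvMat_swap, mul_neg, Matrix.neg_apply]

theorem riemannLow_swap' (hG : IsLocalMetric U G) (hu : u ∈ U) (i j k l : Fin 4) :
    riemannLow G u i j l k = -riemannLow G u i j k l := by
  rw [hG.riemannLow_eq hu, hG.riemannLow_eq hu]
  have h : G u * curvMat G i j u = -(G u * curvMat G i j u)ᵀ := by
    rw [transpose_mul, hG.symm u hu, hG.curvMat_skew hu]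
  exact congrFun (congrFun h l) k

theorem riemannLow_bianchi (hG : IsLocalMetric U G) (hu : u ∈ U) (i j k l : Fin 4) :
    riemannLow G u i j k l + riemannLow G u j k i l + riemannLow G u k i j l = 0 := by
  rw [← neg_eq_zero, ← Finset.sum_const_zero (s := (Finset.univ : Finset (Fin 4)))]
  simp only [riemannLow, ← Finset.sum_add_distrib, ← Finset.sum_neg_distrib]
  refine Finset.sum_congr rfl fun m _ => ?_
  rw [riemann_eq_curvMat, riemann_eq_curvMat, riemann_eq_curvMat]
  linear_combination G u m l * hG.curvMat_bianchi hu i j k m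

/-- The octahedron argument: four cyclic Bianchi identities combined with skewness in each pair of
indices. -/
theorem riemannLow_pair (hG : IsLocalMetric U G) (hu : u ∈ U) (i j k l : Fin 4) :
    riemannLow G u i j k l = riemannLow G u k l i j := by
  have b := hG.riemannLow_bianchi hu
  have s := hG.riemannLow_swap hu
  have s' := hG.riemannLow_swap' hu
  have b1 := b i j k l
  have b2 := b j k l i
  have b3 := b k l i j
  have b4 := b l i j k
  linarith [s' j k i l, s' k l i j, s' l i j k, s' i j k l, s k i l j, s' k i j l, s l j i k,
    s' l j k i]

/-- The Ricci identity for fields of endomorphisms. -/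
theorem covEndo_comm (hG : IsLocalMetric U G) (hu : u ∈ U) {A : E4 → Mat} (hA : SmoothMat U A)
    (i j : Fin 4) : covEndo G i (covEndo G j A) u - covEndo G j (covEndo G i A) u =
      curvMat G i j u * A u - A u * curvMat G i j u := by
  have e : ∀ a b, pdMat a (covEndo G b A) u = pdMat a (pdMat b A) u
      + (pdMat a (connMat G b) u * A u + connMat G b u * pdMat a A u)
      - (pdMat a A u * connMat G b u + A u * pdMat a (connMat G b) u) := by
    intro a b
    have hb := hG.smooth_connMat b
    have hd := hA.pdMat hG.isOpen b
    unfold covEndo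
    rw [pdMat_sub hG.isOpen hu (hd.add (hb.mul hA)) (hA.mul hb),
      pdMat_add hG.isOpen hu hd (hb.mul hA), pdMat_mul hG.isOpen hu hb hA,
      pdMat_mul hG.isOpen hu hA hb]
  rw [covEndo, e, covEndo.eq_def G j (covEndo G i A), e, pdMat_comm hG.isOpen hu hA i j]
  simp only [covEndo, curvMat]
  noncomm_ring

/-- The Ricci identity for covectors. -/
theorem covRow_comm (hG : IsLocalMetric U G) (hu : u ∈ U) {A : E4 → Mat} (hA : SmoothMat U A)
    (i j : Fin 4) : covRow G i (covRow G j A) u - covRow G j (covRow G i A) u =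
      -(A u * curvMat G i j u) := by
  have e : ∀ a b, pdMat a (covRow G b A) u = pdMat a (pdMat b A) u
      - (pdMat a A u * connMat G b u + A u * pdMat a (connMat G b) u) := by
    intro a b
    have hb := hG.smooth_connMat b
    have hd := hA.pdMat hG.isOpen b
    unfold covRow
    rw [pdMat_sub hG.isOpen hu hd (hA.mul hb), pdMat_mul hG.isOpen hu hA hb]
  rw [covRow, e, covRow.eq_def G j (covRow G i A), e, pdMat_comm hG.isOpen hu hA i j]
  simp only [covRow, curvMat]
  noncomm_ring

theorem covEndo_mul (hG : IsLocalMetric U G) (hu : u ∈ U) {A B : E4 → Mat} (hA : SmoothMat U A)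
    (hB : SmoothMat U B) (i : Fin 4) :
    covEndo G i (fun v => A v * B v) u = covEndo G i A u * B u + A u * covEndo G i B u := by
  simp only [covEndo, pdMat_mul hG.isOpen hu hA hB]
  noncomm_ring

theorem covForm_transpose_mul (hG : IsLocalMetric U G) (hu : u ∈ U) {A : E4 → Mat}
    (hA : SmoothMat U A) (i : Fin 4) :
    covForm G i (fun v => (A v)ᵀ * G v) u = (covEndo G i A u)ᵀ * G u := by
  simp only [covForm, covEndo, pdMat_mul hG.isOpen hu hA.transpose hG.smooth, pdMat_transpose,
    hG.pdMat_metric hu, transpose_sub, transpose_add, transpose_mul]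
  noncomm_ring

end IsLocalMetric

/-! ### Integrability and the Lee form determine the derivatives of the triple. -/

/-- The Nijenhuis tensor of `J` in terms of the covariant derivatives `D l` of `J`. -/
noncomputable def nijenhuisOf (J : Mat) (D : Fin 4 → Mat) (k i j : Fin 4) : ℝ :=
  ∑ l, (J l i * D l k j - J l j * D l k i - J k l * (D i l j - D j l i))

/-- The connection is torsion-free: replacing ∂ by D adds Christoffel terms that cancel in pairs by
symmetry of the lower indices. -/
theorem IsLocalMetric.nijenhuis_eq {U : Set E4} {G : E4 → Mat} {u : E4} (hG : IsLocalMetric U G)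
    (hu : u ∈ U) (J : E4 → Mat) (k i j : Fin 4) :
    nijenhuis J u k i j = nijenhuisOf (J u) (fun l => covEndo G l J u) k i j := by
  have s := hG.connMat_symm hu
  have hA : ∑ l, J u l i * (connMat G l u * J u) k j =
      ∑ l, J u l j * (connMat G l u * J u) k i := by
    simp only [Matrix.mul_apply, Finset.mul_sum]
    rw [Finset.sum_comm]
    refine Finset.sum_congr rfl fun l _ => Finset.sum_congr rfl fun m _ => ?_
    rw [s l m k]; ring
  have hB : ∀ i j, ∑ l, J u l i * (J u * connMat G l u) k j
      = ∑ l, J u k l * (connMat G j u * J u) l i := by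
    intro i j
    simp only [Matrix.mul_apply, Finset.mul_sum]
    rw [Finset.sum_comm]
    refine Finset.sum_congr rfl fun l _ => Finset.sum_congr rfl fun m _ => ?_
    rw [s m j l]; ring
  have hE : ∑ l, J u k l * (J u * connMat G i u) l j =
      ∑ l, J u k l * (J u * connMat G j u) l i := by
    refine Finset.sum_congr rfl fun l _ => ?_
    simp only [Matrix.mul_apply]
    congr 1
    exact Finset.sum_congr rfl fun m _ => by rw [s i j m]
  have e : nijenhuisOf (J u) (fun l => covEndo G l J u) k i j = nijenhuis J u k i j
      + (∑ l, J u l i * (connMat G l u * J u) k j - ∑ l, J u l j * (connMat G l u * J u) k i)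
      - (∑ l, J u l i * (J u * connMat G l u) k j - ∑ l, J u k l * (connMat G j u * J u) l i)
      + (∑ l, J u l j * (J u * connMat G l u) k i - ∑ l, J u k l * (connMat G i u * J u) l j)
      + (∑ l, J u k l * (J u * connMat G i u) l j - ∑ l, J u k l * (J u * connMat G j u) l i) := by
    simp only [nijenhuisOf, nijenhuis, ← Finset.sum_sub_distrib, ← Finset.sum_add_distrib]
    refine Finset.sum_congr rfl fun l _ => ?_
    simp only [covEndo, Matrix.sub_apply, Matrix.add_apply, pdMat, of_apply]
    ring
  rw [e, hA, hB i j, hB j i, hE]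
  ring

/-- Each Christoffel term of one cyclic summand cancels against one from another, by symmetry of the
lower indices and skewness of F. -/
theorem IsLocalMetric.dTwo_eq {U : Set E4} {G : E4 → Mat} {u : E4} (hG : IsLocalMetric U G)
    (hu : u ∈ U) {F : E4 → Mat} (hF : (F u)ᵀ = -F u) (i j k : Fin 4) :
    dTwo F u i j k = covForm G i F u j k + covForm G j F u k i + covForm G k F u i j := by
  have s := hG.connMat_symm hu
  have f : ∀ a b, F u a b = -F u b a := fun a b => by
    rw [← Matrix.neg_apply, ← hF, transpose_apply]
  have h : ∀ a b c, ((connMat G a u)ᵀ * F u) b c = -(F u * connMat G b u) c a := by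
    intro a b c
    simp only [Matrix.mul_apply, transpose_apply, ← Finset.sum_neg_distrib]
    refine Finset.sum_congr rfl fun m _ => ?_
    rw [s a b m, f m c]; ring
  simp only [dTwo, covForm, Matrix.sub_apply, h, pdMat, of_apply]
  ring

theorem sum_wedge (α X Y Z : Fin 4 → ℝ) (ψ : Mat) :
    ∑ i, ∑ j, ∑ k, X i * Y j * Z k * wedge α ψ i j k =
      (α ⬝ᵥ X) * (Y ⬝ᵥ ψ *ᵥ Z) + (α ⬝ᵥ Y) * (Z ⬝ᵥ ψ *ᵥ X) + (α ⬝ᵥ Z) * (X ⬝ᵥ ψ *ᵥ Y) := by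
  simp only [wedge, dotProduct, mulVec, Fin.sum_univ_four]
  ring

theorem wedge_smul_sub (α β : Fin 4 → ℝ) (φ ψ : Mat) (i j k : Fin 4) :
    (α i • φ - β i • ψ) j k + (α j • φ - β j • ψ) k i + (α k • φ - β k • ψ) i j =
      wedge α φ i j k - wedge β ψ i j k := by
  simp only [wedge, Matrix.sub_apply, Matrix.smul_apply, smul_eq_mul]
  ring

namespace IsQuaternionic

variable {G J₁ J₂ J₃ : Mat}

theorem pos_single (Q : IsQuaternionic G J₁ J₂ J₃) (i : Fin 4) :
    0 < Pi.single i (1 : ℝ) ⬝ᵥ G *ᵥ Pi.single i 1 :=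
  Q.pos _ fun h => by simpa using congrFun h i

/-- If `D X J₁ = c(X) J₂ - b(X) J₃` and `J₁` is integrable then `b = c ∘ J₁`. -/
theorem eq_of_nijenhuis (Q : IsQuaternionic G J₁ J₂ J₃) {b c : Fin 4 → ℝ}
    (hN : ∀ k i j, nijenhuisOf J₁ (fun i => c i • J₂ - b i • J₃) k i j = 0) :
    c ᵥ* J₁ = b := by
  -- With p = c∘J₁ − b and q = b∘J₁ + c, the relation J₁J₂ = J₃ turns the Nijenhuis tensor into p∧J₂
  -- − q∧J₃.
  obtain ⟨p, hp⟩ : ∃ p, p = c ᵥ* J₁ - b := ⟨_, rfl⟩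
  obtain ⟨q, hq⟩ : ∃ q, q = b ᵥ* J₁ + c := ⟨_, rfl⟩
  have h1 : ∀ k i j, p i * J₂ k j - q i * J₃ k j - p j * J₂ k i + q j * J₃ k i = 0 := by
    intro k i j
    rw [← hN k i j]
    have e₂ : ∀ x, J₃ k x = ∑ l, J₁ k l * J₂ l x := fun x => by rw [← Matrix.mul_apply, Q.mul₁₂]
    have e₃ : ∀ x, J₂ k x = -∑ l, J₁ k l * J₃ l x := fun x => by
      rw [← Matrix.mul_apply, Q.mul₁₃, Matrix.neg_apply, neg_neg]
    have ep : ∀ x, p x = ∑ l, c l * J₁ l x - b x := fun x => by rw [hp]; rfl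
    have eq' : ∀ x, q x = ∑ l, b l * J₁ l x + c x := fun x => by rw [hq]; rfl
    have : nijenhuisOf J₁ (fun i => c i • J₂ - b i • J₃) k i j =
        (∑ l, c l * J₁ l i) * J₂ k j - (∑ l, b l * J₁ l i) * J₃ k j
        - (∑ l, c l * J₁ l j) * J₂ k i + (∑ l, b l * J₁ l j) * J₃ k i
        - c i * (∑ l, J₁ k l * J₂ l j) + b i * (∑ l, J₁ k l * J₃ l j)
        + c j * (∑ l, J₁ k l * J₂ l i) - b j * (∑ l, J₁ k l * J₃ l i) := by
      simp only [nijenhuisOf, Finset.sum_mul, Finset.mul_sum, ← Finset.sum_sub_distrib,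
        ← Finset.sum_add_distrib, Matrix.sub_apply, Matrix.smul_apply, smul_eq_mul]
      exact Finset.sum_congr rfl fun l _ => by ring
    rw [this, ← e₂, ← e₂, ep, ep, eq', eq']
    linear_combination (-b i) * e₃ j + b j * e₃ i
  have h2 : ∀ X Y : Fin 4 → ℝ, (p ⬝ᵥ X) • (J₂ *ᵥ Y) - (q ⬝ᵥ X) • (J₃ *ᵥ Y)
      - (p ⬝ᵥ Y) • (J₂ *ᵥ X) + (q ⬝ᵥ Y) • (J₃ *ᵥ X) = 0 := by
    intro X Y
    ext k
    have h3 : ∑ i, ∑ j, X i * Y j * (p i * J₂ k j - q i * J₃ k j - p j * J₂ k i + q j * J₃ k i)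
        = 0 := by simp only [h1, mul_zero, Finset.sum_const_zero]
    simp only [Fin.sum_univ_four] at h3
    simp only [Pi.sub_apply, Pi.add_apply, Pi.smul_apply, mulVec, dotProduct, Fin.sum_univ_four,
      smul_eq_mul, Pi.zero_apply]
    linear_combination h3
  suffices h : p = 0 by rw [hp] at h; exact sub_eq_zero.1 h
  ext i
  -- Taking Y = J₂X and pairing with X leaves only ±p(X)|X|², because J₁X, J₂X and J₃X are
  -- orthogonal to X.
  have h3 := congrArg (fun w => w ⬝ᵥ G *ᵥ Pi.single i (1 : ℝ))
    (h2 (Pi.single i 1) (J₂ *ᵥ Pi.single i 1))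
  simp only [add_dotProduct, sub_dotProduct, smul_dotProduct, zero_dotProduct] at h3
  have z : ∀ {J : Mat}, G * J = -(Jᵀ * G) →
      (J *ᵥ Pi.single i (1 : ℝ)) ⬝ᵥ G *ᵥ Pi.single i (1 : ℝ) = 0 := by
    intro J hJ
    rw [dotProduct_mulVec_comm Q.symm, dotProduct_mulVec_skew_self Q.symm hJ]
  rw [mulVec_mulVec _ J₂, mulVec_mulVec _ J₃, Q.mul₂₂, Q.mul₃₂, z Q.skew₂, z Q.skew₃, neg_mulVec,
    neg_mulVec, neg_dotProduct, neg_dotProduct, z Q.skew₁, one_mulVec] at h3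
  have h4 := Q.pos_single i
  have h5 : p ⬝ᵥ Pi.single i 1 = p i := by simp
  rw [h5] at h3
  simp only [smul_eq_mul, mul_zero, neg_zero, sub_zero, add_zero, mul_neg, neg_eq_zero] at h3
  exact (mul_eq_zero.1 h3).resolve_right h4.ne'

/-- The covariant derivatives of an integrable triple in terms of the Lee form of `J₁`. -/
theorem covariant_derivatives (Q : IsQuaternionic G J₁ J₂ J₃) {D₁ D₂ D₃ : Fin 4 → Mat}
    {t : Fin 4 → ℝ}
    (s₁ : ∀ i, G * D₁ i = -((D₁ i)ᵀ * G)) (s₂ : ∀ i, G * D₂ i = -((D₂ i)ᵀ * G))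
    (s₃ : ∀ i, G * D₃ i = -((D₃ i)ᵀ * G))
    (h₁ : ∀ i, D₁ i * J₁ + J₁ * D₁ i = 0) (h₂ : ∀ i, D₂ i * J₂ + J₂ * D₂ i = 0)
    (h₃ : ∀ i, D₃ i * J₃ + J₃ * D₃ i = 0)
    (h₁₂ : ∀ i, D₁ i * J₂ + J₁ * D₂ i + (D₂ i * J₁ + J₂ * D₁ i) = 0)
    (h₂₃ : ∀ i, D₂ i * J₃ + J₂ * D₃ i + (D₃ i * J₂ + J₃ * D₂ i) = 0)
    (h₃₁ : ∀ i, D₃ i * J₁ + J₃ * D₁ i + (D₁ i * J₃ + J₁ * D₃ i) = 0)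
    (N₁ : ∀ k i j, nijenhuisOf J₁ D₁ k i j = 0) (N₂ : ∀ k i j, nijenhuisOf J₂ D₂ k i j = 0)
    (lee : ∀ i j k, ((D₁ i)ᵀ * G) j k + ((D₁ j)ᵀ * G) k i + ((D₁ k)ᵀ * G) i j =
      -2 * wedge t (J₁ᵀ * G) i j k) (i : Fin 4) :
    D₁ i = (t ᵥ* J₃) i • J₂ - (t ᵥ* J₂) i • J₃ ∧ D₂ i = (t ᵥ* J₁) i • J₃ - (t ᵥ* J₃) i • J₁ ∧
      D₃ i = (t ᵥ* J₂) i • J₁ - (t ᵥ* J₁) i • J₂ := by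
  have tr : ∀ {A B E F : Mat}, A * B + E * F + (F * E + B * A) = 0 →
      (A * B).trace = -(F * E).trace := by
    intro A B E F h
    have := congrArg trace h
    rw [trace_add, trace_add, trace_add, trace_mul_comm E, trace_mul_comm B, trace_zero] at this
    linarith
  -- Each derivative lies in the span of the two other members. The differentiated anticommutation
  -- relations identify the six coefficients in pairs, so three 1-forms remain.
  obtain ⟨a, ha⟩ : ∃ a : Fin 4 → ℝ, ∀ i, a i = -(D₂ i * J₃).trace / 4 := ⟨_, fun _ => rfl⟩
  obtain ⟨b, hb⟩ : ∃ b : Fin 4 → ℝ, ∀ i, b i = -(D₃ i * J₁).trace / 4 := ⟨_, fun _ => rfl⟩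
  obtain ⟨c, hc⟩ : ∃ c : Fin 4 → ℝ, ∀ i, c i = -(D₁ i * J₂).trace / 4 := ⟨_, fun _ => rfl⟩
  have e₁ : D₁ = fun i => c i • J₂ - b i • J₃ := by
    funext i
    rw [Q.eq_of_anticommute (s₁ i) (eq_neg_of_add_eq_zero_left (h₁ i)), hc, hb, tr (h₃₁ i)]
    module
  have e₂ : D₂ = fun i => a i • J₃ - c i • J₁ := by
    funext i
    rw [Q.rotate.eq_of_anticommute (s₂ i) (eq_neg_of_add_eq_zero_left (h₂ i)), ha, hc, tr (h₁₂ i)]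
    module
  have e₃ : D₃ = fun i => b i • J₁ - a i • J₂ := by
    funext i
    rw [Q.rotate.rotate.eq_of_anticommute (s₃ i) (eq_neg_of_add_eq_zero_left (h₃ i)), hb, ha,
      tr (h₂₃ i)]
    module
  have hcb : c ᵥ* J₁ = b := Q.eq_of_nijenhuis (by rw [← e₁]; exact N₁)
  have hac : a ᵥ* J₂ = c := Q.rotate.eq_of_nijenhuis (by rw [← e₂]; exact N₂)
  -- τ solves τ∘J₁ = a; the two Nijenhuis relations then give τ∘J₂ = b and τ∘J₃ = c. It remains to
  -- recognise τ as the Lee form.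
  obtain ⟨τ, hτ⟩ : ∃ τ, τ = -(a ᵥ* J₁) := ⟨_, rfl⟩
  have τ₁ : τ ᵥ* J₁ = a := by
    rw [hτ, neg_vecMul, vecMul_vecMul, Q.mul₁₁, vecMul_neg, vecMul_one, neg_neg]
  have τ₂ : τ ᵥ* J₂ = b := by
    rw [hτ, neg_vecMul, vecMul_vecMul, Q.mul₁₂, ← hcb, ← hac, vecMul_vecMul, Q.mul₂₁, vecMul_neg]
  have τ₃ : τ ᵥ* J₃ = c := by
    rw [hτ, neg_vecMul, vecMul_vecMul, Q.mul₁₃, vecMul_neg, hac, neg_neg]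
  suffices h : t = τ by rw [h, τ₁, τ₂, τ₃, e₁, e₂, e₃]; exact ⟨rfl, rfl, rfl⟩
  ext x
  have hw : ∀ i j k, wedge c (J₂ᵀ * G) i j k - wedge b (J₃ᵀ * G) i j k =
      -2 * wedge t (J₁ᵀ * G) i j k := by
    intro i j k
    rw [← lee, ← wedge_smul_sub, e₁]
    simp only [transpose_sub, transpose_smul, sub_mul, smul_mul_assoc]
  -- Evaluated on (X, J₂X, J₃X), the Lee equation of J₁ reduces to t(X)|X|² = τ(X)|X|².
  obtain ⟨X, hX⟩ : ∃ X : Fin 4 → ℝ, X = Pi.single x 1 := ⟨_, rfl⟩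
  have hpos : 0 < X ⬝ᵥ G *ᵥ X := by rw [hX]; exact Q.pos_single x
  have hsum : ∑ i, ∑ j, ∑ k, X i * (J₂ *ᵥ X) j * (J₃ *ᵥ X) k * wedge c (J₂ᵀ * G) i j k
      - ∑ i, ∑ j, ∑ k, X i * (J₂ *ᵥ X) j * (J₃ *ᵥ X) k * wedge b (J₃ᵀ * G) i j k
      = -2 * ∑ i, ∑ j, ∑ k, X i * (J₂ *ᵥ X) j * (J₃ *ᵥ X) k * wedge t (J₁ᵀ * G) i j k := by
    simp only [← Finset.sum_sub_distrib, Finset.mul_sum, ← mul_sub, hw]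
    refine Finset.sum_congr rfl fun i _ => Finset.sum_congr rfl fun j _ =>
      Finset.sum_congr rfl fun k _ => by ring
  have m : ∀ {A B C : Mat}, A * B = C → A *ᵥ (B *ᵥ X) = C *ᵥ X := by
    rintro A B C rfl; exact mulVec_mulVec _ _ _
  have F : ∀ (J : Mat) (Y Z : Fin 4 → ℝ), Y ⬝ᵥ (Jᵀ * G) *ᵥ Z = (J *ᵥ Y) ⬝ᵥ G *ᵥ Z := by
    intro J Y Z
    rw [← mulVec_mulVec, dotProduct_mulVec Y, vecMul_transpose]
  have z := fun {J : Mat} (hJ : G * J = -(Jᵀ * G)) => dotProduct_mulVec_skew_self Q.symm hJ X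
  have z₁ := z Q.skew₁
  have z₂ := z Q.skew₂
  have z₃ := z Q.skew₃
  have k₁ := fun Y Z => dotProduct_mulVec_skew Q.skew₁ Y Z
  have k₂ := fun Y Z => dotProduct_mulVec_skew Q.skew₂ Y Z
  have k₃ := fun Y Z => dotProduct_mulVec_skew Q.skew₃ Y Z
  rw [sum_wedge, sum_wedge, sum_wedge] at hsum
  have v₃ : c ⬝ᵥ J₃ *ᵥ X = -(τ ⬝ᵥ X) := by
    rw [dotProduct_mulVec, ← τ₃, vecMul_vecMul, Q.mul₃₃, vecMul_neg, vecMul_one, neg_dotProduct]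
  have v₂ : b ⬝ᵥ J₂ *ᵥ X = -(τ ⬝ᵥ X) := by
    rw [dotProduct_mulVec, ← τ₂, vecMul_vecMul, Q.mul₂₂, vecMul_neg, vecMul_one, neg_dotProduct]
  simp [F, k₁, k₂, k₃, z₁, z₂, z₃, m Q.mul₂₂, m Q.mul₃₃, m Q.mul₁₂, m Q.mul₂₃, m Q.mul₃₂,
    m Q.mul₁₃, neg_mulVec, mulVec_neg, -mulVec_mulVec, v₂, v₃]
    at hsum
  have h6 : (t ⬝ᵥ X - τ ⬝ᵥ X) * (X ⬝ᵥ G *ᵥ X) = 0 := by linarith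
  have h7 := (mul_eq_zero.1 h6).resolve_right hpos.ne'
  rw [hX] at h7
  simpa [sub_eq_zero] using h7

end IsQuaternionic

/-! ### The Hodge star, and commutation of self-dual with anti-self-dual forms. -/

/-- The 0-1 matrix defining `eps` carries the Vandermonde matrix of the nodes 0, 1, 2, 3, of
determinant 12, to that of the nodes i, j, k, l. The polynomial form makes `eps` computable entry by
entry. -/
theorem eps_eq (i j k l : Fin 4) : eps i j k l =
    ((j : ℝ) - i) * (k - i) * (l - i) * (k - j) * (l - j) * (l - k) / 12 := by
  have h : (Matrix.of fun a b : Fin 4 => if ![i, j, k, l] a = b then (1 : ℝ) else 0)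
      * vandermonde (fun a : Fin 4 => (a : ℝ)) =
      vandermonde (fun a : Fin 4 => ((![i, j, k, l] a : Fin 4) : ℝ)) := by
    ext a c
    simp [Matrix.mul_apply, vandermonde_apply]
  have hI : ∀ (f : Fin 4 → ℝ), (vandermonde f).det =
      (f 1 - f 0) * (f 2 - f 0) * (f 3 - f 0) * (f 2 - f 1) * (f 3 - f 1) * (f 3 - f 2) := by
    intro f
    have e0 : Finset.Ioi (0 : Fin 4) = {1, 2, 3} := by decide
    have e1 : Finset.Ioi (1 : Fin 4) = {2, 3} := by decide
    have e2 : Finset.Ioi (2 : Fin 4) = {3} := by decide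
    have e3 : Finset.Ioi (3 : Fin 4) = ∅ := by decide
    rw [det_vandermonde, Fin.prod_univ_four, e0, e1, e2, e3]
    simp [-mul_eq_mul_left_iff, -mul_eq_mul_right_iff]
    ring
  have h' := congrArg det h
  rw [det_mul, hI, hI] at h'
  have h3 : ((3 : Fin 4) : ℝ) = 3 := rfl
  simp at h'
  rw [eps]
  norm_num at h'
  linarith

/-- The contraction of a contravariant 2-tensor with the Levi-Civita symbol. -/
noncomputable def epsDual (A : Mat) : Mat :=
  Matrix.of fun k l => (1 / 2) * ∑ i, ∑ j, A i j * eps i j k l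

theorem epsDual_eq {A : Mat} (hA : Aᵀ = -A) : epsDual A =
    !![0, A 2 3, -A 1 3, A 1 2; -A 2 3, 0, A 0 3, -A 0 2; A 1 3, -A 0 3, 0, A 0 1;
      -A 1 2, A 0 2, -A 0 1, 0] := by
  have h : ∀ i j, A i j = -A j i := fun i j => by
    rw [← Matrix.neg_apply, ← hA, transpose_apply]
  have h0 : ∀ i, A i i = 0 := fun i => by linarith [h i i]
  ext k l
  simp only [epsDual, of_apply, Fin.sum_univ_four, h0, h 1 0, h 2 0, h 2 1, h 3 0, h 3 1, h 3 2]
  fin_cases k <;> fin_cases l <;>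
    norm_num [eps_eq] <;> ring

/-- The polarisation of the Pfaffian identity Â A = −Pf(A)·1 for skew 4 × 4 matrices, Â being the
dual of A; the scalar is minus the polar form of the Pfaffian. -/
theorem epsDual_mul_add {A B : Mat} (hA : Aᵀ = -A) (hB : Bᵀ = -B) :
    ∃ c : ℝ, epsDual A * B + epsDual B * A = c • (1 : Mat) := by
  have h : ∀ i j, A i j = -A j i := fun i j => by
    rw [← Matrix.neg_apply, ← hA, transpose_apply]
  have h0 : ∀ i, A i i = 0 := fun i => by linarith [h i i]
  have h' : ∀ i j, B i j = -B j i := fun i j => by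
    rw [← Matrix.neg_apply, ← hB, transpose_apply]
  have h0' : ∀ i, B i i = 0 := fun i => by linarith [h' i i]
  refine ⟨-(A 0 1 * B 2 3 + A 2 3 * B 0 1 - A 0 2 * B 1 3 - A 1 3 * B 0 2 + A 0 3 * B 1 2
    + A 1 2 * B 0 3), ?_⟩
  rw [epsDual_eq hA, epsDual_eq hB]
  ext k l
  simp only [Matrix.add_apply, Matrix.mul_apply, Fin.sum_univ_four]
  fin_cases k <;> fin_cases l <;>
    simp [h0, h0', h 1 0, h 2 0, h 2 1, h 3 0, h 3 1, h 3 2, h' 1 0, h' 2 0, h' 2 1, h' 3 0,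
      h' 3 1, h' 3 2] <;> ring

theorem raise_eq (G ψ : Mat) : raise G ψ = G⁻¹ * ψ * (G⁻¹)ᵀ := by
  ext i j
  simp only [raise, of_apply, Matrix.mul_apply, transpose_apply, Finset.sum_mul]
  rw [Finset.sum_comm]
  exact Finset.sum_congr rfl fun a _ => Finset.sum_congr rfl fun b _ => by ring

theorem toEndo_eq (G ψ : Mat) : toEndo G ψ = (ψ * G⁻¹)ᵀ := by
  ext k i
  simp [toEndo, Matrix.mul_apply]

theorem toForm_eq (G A : Mat) : toForm G A = Aᵀ * G := by
  ext k i
  simp [toForm, Matrix.mul_apply]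

theorem hodge_eq (G ψ : Mat) : hodge G ψ = √G.det • epsDual (raise G ψ) := by
  ext k l
  simp only [hodge, epsDual, of_apply, Matrix.smul_apply, smul_eq_mul]
  ring

theorem transpose_raise {G ψ : Mat} (hψ : ψᵀ = -ψ) : (raise G ψ)ᵀ = -raise G ψ := by
  rw [raise_eq, transpose_mul, transpose_mul, transpose_transpose, hψ]
  simp [mul_assoc]

theorem toEndo_eq_neg {G ψ : Mat} (hG : Gᵀ = G) (hψ : ψᵀ = -ψ) : toEndo G ψ = -(G⁻¹ * ψ) := by
  rw [toEndo_eq, transpose_mul, hψ, transpose_nonsing_inv, hG, mul_neg]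

/-- Self-dual and anti-self-dual 2-forms commute. -/
theorem toEndo_commute {G ψ φ : Mat} (hG : Gᵀ = G) (hψ : IsSelfDualForm G ψ)
    (hφ : IsAntiSelfDualForm G φ) :
    toEndo G ψ * toEndo G φ = toEndo G φ * toEndo G ψ := by
  have hG' : (G⁻¹)ᵀ = G⁻¹ := by rw [transpose_nonsing_inv, hG]
  obtain ⟨c, hc⟩ := epsDual_mul_add (transpose_raise (G := G) hψ.1) (transpose_raise (G := G) hφ.1)
  have h1 : ψ * raise G φ - φ * raise G ψ = (√G.det * c) • (1 : Mat) := by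
    have e1 := hψ.2
    have e2 := hφ.2
    rw [hodge_eq] at e1 e2
    rw [mul_smul, ← hc, smul_add, ← smul_mul_assoc, ← smul_mul_assoc, e1, e2, neg_mul,
      sub_eq_add_neg]
  rw [raise_eq, raise_eq, hG'] at h1
  -- The opposite eigenvalues of the star turn the anticommutator-like identity into a difference;
  -- its two products have equal traces, so the scalar is zero.
  have h2 := congrArg trace h1
  have h3 : (ψ * (G⁻¹ * φ * G⁻¹)).trace = (φ * (G⁻¹ * ψ * G⁻¹)).trace := by
    rw [mul_assoc, ← mul_assoc ψ, trace_mul_comm, mul_assoc, mul_assoc]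
  rw [trace_sub, h3, sub_self, trace_smul, trace_one] at h2
  have h4 : √G.det * c = 0 := by simpa using h2
  rw [h4, zero_smul, sub_eq_zero] at h1
  rw [toEndo_eq, toEndo_eq, ← transpose_mul, ← transpose_mul, mul_assoc, mul_assoc,
    ← mul_assoc G⁻¹, ← mul_assoc G⁻¹, h1]

theorem trace_transpose_mul_vecMulVec (P : Mat) (x y : Fin 4 → ℝ) :
    (Pᵀ * vecMulVec x y).trace = x ⬝ᵥ P *ᵥ y := by
  rw [mul_vecMulVec, trace_vecMulVec, mulVec_transpose, dotProduct_mulVec]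

theorem trace_transpose_mul_eq_sum (P A : Mat) : (Pᵀ * A).trace = ∑ i, ∑ j, P i j * A i j := by
  simp only [trace, diag_apply, Matrix.mul_apply, transpose_apply]
  exact Finset.sum_comm

/-! ### Pointwise identities between the curvature, the triple and a covector. -/

namespace IsQuaternionic

variable {G J₁ J₂ J₃ : Mat}

theorem inv_mul (Q : IsQuaternionic G J₁ J₂ J₃) : G⁻¹ * G = 1 :=
  nonsing_inv_mul _ (isUnit_iff_ne_zero.2 Q.det_ne_zero)

theorem mul_inv (Q : IsQuaternionic G J₁ J₂ J₃) : G * G⁻¹ = 1 :=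
  mul_nonsing_inv _ (isUnit_iff_ne_zero.2 Q.det_ne_zero)

theorem transpose_inv (Q : IsQuaternionic G J₁ J₂ J₃) : (G⁻¹)ᵀ = G⁻¹ := by
  rw [transpose_nonsing_inv, Q.symm]

theorem mul_inv_eq (Q : IsQuaternionic G J₁ J₂ J₃) {A : Mat} (h : G * A = -(Aᵀ * G)) :
    A * G⁻¹ = -(G⁻¹ * Aᵀ) := by
  calc A * G⁻¹ = G⁻¹ * (G * A) * G⁻¹ := by rw [← mul_assoc, Q.inv_mul, one_mul]
    _ = _ := by rw [h, mul_neg, neg_mul, mul_assoc, mul_assoc Aᵀ, Q.mul_inv, mul_one]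

/-- A bilinear form commuting with the triple gives an endomorphism commuting with it. -/
theorem inv_mul_commute (Q : IsQuaternionic G J₁ J₂ J₃) {A J : Mat} (hJ : G * J = -(Jᵀ * G))
    (h : A * J = -(Jᵀ * A)) : G⁻¹ * A * J = J * (G⁻¹ * A) := by
  rw [mul_assoc, h, ← mul_assoc, Q.mul_inv_eq hJ, mul_neg, neg_mul, mul_assoc]

theorem trace_eq_zero (Q : IsQuaternionic G J₁ J₂ J₃) : J₁.trace = 0 := by
  have h : J₁.trace = -J₁.trace := by
    conv_lhs => rw [← Q.mul₂₃, trace_mul_comm, Q.mul₃₂, trace_neg]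
  linarith

theorem dotProduct_inv_mulVec (Q : IsQuaternionic G J₁ J₂ J₃) {t v : Fin 4 → ℝ}
    (hv : v = G⁻¹ *ᵥ t) : G *ᵥ v = t := by
  rw [hv, mulVec_mulVec, Q.mul_inv, one_mulVec]

theorem vecMul_of_eq (Q : IsQuaternionic G J₁ J₂ J₃) {t v : Fin 4 → ℝ}
    (hv : v = G⁻¹ *ᵥ t) : v ᵥ* G = t := by
  rw [← mulVec_transpose, Q.symm, Q.dotProduct_inv_mulVec hv]

theorem mulVec_mulVec_skew (Q : IsQuaternionic G J₁ J₂ J₃) {t v : Fin 4 → ℝ}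
    (hv : v = G⁻¹ *ᵥ t) {A : Mat} (hA : G * A = -(Aᵀ * G)) : G *ᵥ (A *ᵥ v) = -(t ᵥ* A) := by
  rw [mulVec_mulVec, hA, neg_mulVec, ← mulVec_mulVec, Q.dotProduct_inv_mulVec hv, mulVec_transpose]

/-- Twisting the rank-one projection on a vector by the triple gives a multiple of the identity. -/
theorem vecMulVec_sub_conj (Q : IsQuaternionic G J₁ J₂ J₃) {t v : Fin 4 → ℝ}
    (hv : v = G⁻¹ *ᵥ t) :
    vecMulVec v t - J₁ * vecMulVec v t * J₁ - J₂ * vecMulVec v t * J₂ - J₃ * vecMulVec v t * J₃ =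
      (t ⬝ᵥ v) • (1 : Mat) := by
  rw [Q.sub_conj_eq_trace, trace_vecMulVec, dotProduct_comm]
  rw [mul_vecMulVec, Q.dotProduct_inv_mulVec hv, transpose_vecMulVec, vecMulVec_mul,
    Q.vecMul_of_eq hv]

/-- The resolution of the identity `vecMulVec_sub_conj` multiplied by G J₃: the products J₃J₁ = J₂,
J₃J₂ = −J₁, J₃J₃ = −1 permute its rank-one terms. -/
theorem vecMul_wedge (Q : IsQuaternionic G J₁ J₂ J₃) {t v : Fin 4 → ℝ}
    (hv : v = G⁻¹ *ᵥ t) :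
    vecMulVec (t ᵥ* J₁) (t ᵥ* J₂) - vecMulVec (t ᵥ* J₂) (t ᵥ* J₁) =
      vecMulVec t (t ᵥ* J₃) - vecMulVec (t ᵥ* J₃) t + (t ⬝ᵥ v) • (J₃ᵀ * G) := by
  have h := congrArg (fun A => G * (J₃ * A)) (Q.vecMulVec_sub_conj hv)
  have m₁ : J₃ *ᵥ J₁ *ᵥ v = J₂ *ᵥ v := by rw [mulVec_mulVec, Q.mul₃₁]
  have m₂ : J₃ *ᵥ J₂ *ᵥ v = -(J₁ *ᵥ v) := by rw [mulVec_mulVec, Q.mul₃₂, neg_mulVec]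
  have m₃ : J₃ *ᵥ J₃ *ᵥ v = -v := by rw [mulVec_mulVec, Q.mul₃₃, neg_mulVec, one_mulVec]
  simp only [mul_sub, m₁, m₂, m₃, vecMulVec_mul, mul_vecMulVec, Matrix.mul_smul, mul_one, mul_neg,
    Q.mulVec_mulVec_skew hv Q.skew₁, Q.mulVec_mulVec_skew hv Q.skew₂,
    Q.mulVec_mulVec_skew hv Q.skew₃, Q.dotProduct_inv_mulVec hv, Q.skew₃, neg_vecMulVec, smul_neg]
    at h
  rw [← sub_eq_zero] at h ⊢
  rw [← neg_eq_zero, ← h]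
  abel

/-- The decomposition of a covariant derivative `T` of a 1-form whose twists by the triple are
prescribed. -/
theorem form_decomp (Q : IsQuaternionic G J₁ J₂ J₃) {S : Mat}
    (h₁ : S * J₁ = (S * J₁)ᵀ) (h₂ : S * J₂ = (S * J₂)ᵀ) (h₃ : S * J₃ = (S * J₃)ᵀ) :
    Sᵀ = -S ∧ S * J₁ = -(J₁ᵀ * S) ∧ S * J₂ = -(J₂ᵀ * S) ∧ S * J₃ = -(J₃ᵀ * S) := by
  rw [transpose_mul] at h₁ h₂ h₃
  have h₂' : Sᵀ * J₂ = J₂ᵀ * S := by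
    have h := congrArg (fun A => J₂ᵀ * (A * J₂)) h₂
    simp only [mul_assoc, Q.mul₂₂, mul_neg, mul_one] at h
    rw [← mul_assoc, ← transpose_mul, Q.mul₂₂, transpose_neg, transpose_one, neg_one_mul,
      neg_inj] at h
    exact h.symm
  -- Since J₃ = −J₂J₁, the relations for J₁ and J₂ already give this one; comparing it with the
  -- hypothesis on J₃ makes S skew.
  have e : S * J₃ = -(J₃ᵀ * S) := by
    rw [← neg_mul, ← transpose_neg, ← Q.mul₂₁, transpose_mul, mul_assoc, ← h₂', ← mul_assoc, ← h₁,
      mul_assoc, Q.mul₁₂]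
  have hS : Sᵀ = -S := by
    have h := congrArg (fun A => J₃ᵀ * A) (h₃.symm.trans e)
    simp only [mul_neg] at h
    rw [← mul_assoc, ← mul_assoc, ← transpose_mul, Q.mul₃₃, transpose_neg, transpose_one,
      neg_one_mul, neg_one_mul, neg_inj] at h
    exact h
  refine ⟨hS, ?_, ?_, e⟩
  · rw [h₁, hS, mul_neg]
  · rw [h₂, hS, mul_neg]

/-- Pair symmetry makes the curvature operator symmetric, so feeding the bivector of J₁ into the
form indices gives the same scalar as tracing J₁ against the endomorphism. -/
theorem sum_smul_curvature (Q : IsQuaternionic G J₁ J₂ J₃) {C : Fin 4 → Fin 4 → Mat} {s : ℝ}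
    (pair : ∀ i j k l, (G * C i j) k l = (G * C k l) i j)
    (tr : ∀ i j, (J₁ * C i j).trace = s / 6 * (J₁ᵀ * G) i j) :
    ∑ i, ∑ j, (J₁ * G⁻¹) i j • C i j = (s / 6) • J₁ := by
  have h : G * ∑ i, ∑ j, (J₁ * G⁻¹) i j • C i j = G * ((s / 6) • J₁) := by
    ext k l
    have h1 : (G * ∑ i, ∑ j, (J₁ * G⁻¹) i j • C i j) k l =
        ∑ i, ∑ j, (J₁ * G⁻¹) i j * (G * C k l) i j := by
      simp only [Finset.mul_sum, Matrix.mul_smul, Matrix.sum_apply, Matrix.smul_apply,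
        smul_eq_mul, pair]
    rw [h1, ← trace_transpose_mul_eq_sum, Q.mul_inv_eq Q.skew₁, transpose_neg, transpose_mul,
      transpose_transpose, Q.transpose_inv, neg_mul, trace_neg, mul_assoc, ← mul_assoc G⁻¹,
      Q.inv_mul, one_mul, tr, Matrix.mul_smul, Q.skew₁, Matrix.smul_apply, Matrix.neg_apply,
      smul_eq_mul]
    ring
  have := congrArg (fun A => G⁻¹ * A) h
  simpa only [← mul_assoc, Q.inv_mul, one_mul] using this

variable {C : Fin 4 → Fin 4 → Mat} {E : Fin 4 → Mat} {Φ T : Mat} {t v d : Fin 4 → ℝ} {s c : ℝ}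

/-- Here E is DΦ, T is Dθ and d is dc. As E k commutes with J₂, its pairing with the bivector of J₁
vanishes; in `hEk` this is a linear equation that determines d. The argument does not invoke
constancy of s, which may be a function when c is differentiated. -/
theorem differential_eq (Q : IsQuaternionic G J₁ J₂ J₃) (hv : v = G⁻¹ *ᵥ t)
    (pair : ∀ i j k l, (G * C i j) k l = (G * C k l) i j)
    (tr : ∀ i j, (J₁ * C i j).trace = s / 6 * (J₁ᵀ * G) i j)
    (hE : ∀ k, E k * J₂ = -(J₂ᵀ * E k)) (hΦ₁ : Φ * J₁ = -(J₁ᵀ * Φ)) (hΦ₂ : Φ * J₂ = -(J₂ᵀ * Φ))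
    (hT : T = (1 / 2 : ℝ) • Φ + vecMulVec t t + c • G)
    (hEk : ∀ i j k, E k i j = 2 * (t ᵥ* C i j) k + 2 * (Φ i j * t k)
      + 2 * (t j * T i k - t i * T j k) + 2 * (d i * G j k - d j * G i k)) :
    d = (1 / 2 : ℝ) • (v ᵥ* Φ) + (c - s / 12) • t := by
  obtain ⟨P, hP⟩ : ∃ P, P = J₁ * G⁻¹ := ⟨_, rfl⟩
  have hPT : Pᵀ = -P := by
    rw [hP, Q.mul_inv_eq Q.skew₁, transpose_neg, transpose_mul, transpose_transpose,
      Q.transpose_inv,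
      Q.mul_inv_eq Q.skew₁]
  have hzero : ∀ A : Mat, A * J₂ = -(J₂ᵀ * A) → (Pᵀ * A).trace = 0 := by
    intro A hA
    rw [hPT, hP, neg_mul, trace_neg, mul_assoc, trace_mul_comm,
      Q.trace_mul_eq_zero (Q.inv_mul_commute Q.skew₂ hA), neg_zero]
  have hskew : ∀ x y, x ⬝ᵥ P *ᵥ y = -(y ⬝ᵥ P *ᵥ x) := by
    intro x y
    rw [dotProduct_mulVec, ← mulVec_transpose, hPT, neg_mulVec, neg_dotProduct, dotProduct_comm]
  have hPt : P *ᵥ t = J₁ *ᵥ v := by rw [hP, hv, mulVec_mulVec]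
  have hz : (J₁ *ᵥ v) ⬝ᵥ t = 0 := by
    rw [← Q.dotProduct_inv_mulVec hv, dotProduct_mulVec_comm Q.symm,
      dotProduct_mulVec_skew_self Q.symm Q.skew₁]
  have hTJ : (J₁ *ᵥ v) ᵥ* T = -((1 / 2 : ℝ) • (v ᵥ* Φ ᵥ* J₁)) - c • (t ᵥ* J₁) := by
    have e : ∀ A : Mat, A * J₁ = -(J₁ᵀ * A) → (J₁ *ᵥ v) ᵥ* A = -(v ᵥ* A ᵥ* J₁) := by
      intro A hA
      rw [vecMul_vecMul, hA, ← vecMul_transpose, vecMul_vecMul, vecMul_neg, neg_neg]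
    rw [hT, vecMul_add, vecMul_add, vecMul_smul, vecMul_smul, e Φ hΦ₁, e G Q.skew₁,
      Q.vecMul_of_eq hv, vecMul_vecMulVec, hz]
    simp only [zero_smul, smul_neg, add_zero]
    abel
  -- The Φ term of `hEk` pairs to zero with P, the curvature term is given by `sum_smul_curvature`,
  -- and each wedge term counts twice because P is skew.
  have key : ∀ k, 0 = s / 3 * (t ᵥ* J₁) k + 4 * ((J₁ *ᵥ v) ᵥ* T) k + 4 * (d ᵥ* J₁) k := by
    intro k
    have hm : E k = (2 : ℝ) • (Matrix.of fun i j => (t ᵥ* C i j) k) + (2 * t k) • Φ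
        + (2 : ℝ) • (vecMulVec (fun i => T i k) t - vecMulVec t (fun i => T i k))
        + (2 : ℝ) • (vecMulVec d (fun i => G i k) - vecMulVec (fun i => G i k) d) := by
      ext i j
      rw [hEk]
      simp only [Matrix.add_apply, Matrix.smul_apply, Matrix.sub_apply, of_apply, vecMulVec_apply,
        smul_eq_mul]
      ring
    have h0 := hzero (E k) (hE k)
    have h1 : (Pᵀ * (Matrix.of fun i j => (t ᵥ* C i j) k)).trace = s / 6 * (t ᵥ* J₁) k := by
      have h2 := congrArg (fun A => (t ᵥ* A) k) (Q.sum_smul_curvature pair tr)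
      rw [← hP] at h2
      simp only [vecMul_sum, vecMul_smul, Finset.sum_apply, Pi.smul_apply, smul_eq_mul] at h2
      rw [trace_transpose_mul_eq_sum]
      exact h2
    have h3 : (fun i => T i k) ⬝ᵥ J₁ *ᵥ v = ((J₁ *ᵥ v) ᵥ* T) k := dotProduct_comm _ _
    have h4 : d ⬝ᵥ P *ᵥ (fun i => G i k) = (d ᵥ* J₁) k := by
      have : d ᵥ* J₁ = d ᵥ* P ᵥ* G := by
        rw [vecMul_vecMul, hP, mul_assoc, Q.inv_mul, mul_one]
      rw [this, dotProduct_mulVec]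
      rfl
    rw [hm, mul_add, mul_add, mul_add, trace_add, trace_add, trace_add, Matrix.mul_smul,
      Matrix.mul_smul,
      Matrix.mul_smul, Matrix.mul_smul, trace_smul, trace_smul, trace_smul, trace_smul,
      hzero Φ hΦ₂, h1, mul_sub,
      mul_sub, trace_sub, trace_sub, trace_transpose_mul_vecMulVec, trace_transpose_mul_vecMulVec,
      trace_transpose_mul_vecMulVec, trace_transpose_mul_vecMulVec, hskew t, hskew (fun i => G i k),
      hPt, h3, h4] at h0
    simp only [smul_eq_mul] at h0
    linarith
  have hw : ((s / 3) • t - (2 : ℝ) • (v ᵥ* Φ) - (4 * c) • t + (4 : ℝ) • d) ᵥ* J₁ = 0 := by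
    ext k
    have := key k
    rw [hTJ] at this
    simp only [add_vecMul, sub_vecMul, smul_vecMul, Pi.add_apply, Pi.sub_apply, Pi.smul_apply,
      smul_eq_mul, Pi.neg_apply, Pi.zero_apply] at this ⊢
    linarith
  have hw2 := congrArg (fun x => x ᵥ* J₁) hw
  simp only [vecMul_vecMul, Q.mul₁₁, vecMul_neg, vecMul_one, zero_vecMul, neg_eq_zero] at hw2
  ext k
  have := congrFun hw2 k
  simp only [Pi.add_apply, Pi.sub_apply, Pi.smul_apply, smul_eq_mul, Pi.zero_apply] at this ⊢
  linarith

theorem sum_smul_apply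
    (hEk : ∀ i j k, E k i j = 2 * (t ᵥ* C i j) k + 2 * (Φ i j * t k)
      + 2 * (t j * T i k - t i * T j k) + 2 * (d i * G j k - d j * G i k))
    (X : Fin 4 → ℝ) (i j : Fin 4) :
    (∑ k, X k • E k) i j = 2 * ((t ᵥ* C i j) ⬝ᵥ X) + 2 * (Φ i j * (t ⬝ᵥ X))
      + 2 * (t j * (T *ᵥ X) i - t i * (T *ᵥ X) j)
      + 2 * (d i * (G *ᵥ X) j - d j * (G *ᵥ X) i) := by
  simp only [Matrix.sum_apply, Matrix.smul_apply, smul_eq_mul, hEk, dotProduct, mulVec,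
    Finset.mul_sum, ← Finset.sum_add_distrib, ← Finset.sum_sub_distrib]
  exact Finset.sum_congr rfl fun k _ => by ring

/-- The curvature term pairs θ with itself through a skew endomorphism and vanishes. The Φ(θ)∧θ
terms coming from T and from d cancel, leaving only Φ ⊗ θ contracted with θ. -/
theorem derivative_along_dual (Q : IsQuaternionic G J₁ J₂ J₃) (hv : v = G⁻¹ *ᵥ t)
    (skewC : ∀ i j, G * C i j = -((C i j)ᵀ * G)) (hΦT : Φᵀ = -Φ)
    (hT : T = (1 / 2 : ℝ) • Φ + vecMulVec t t + c • G)
    (hEk : ∀ i j k, E k i j = 2 * (t ᵥ* C i j) k + 2 * (Φ i j * t k)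
      + 2 * (t j * T i k - t i * T j k) + 2 * (d i * G j k - d j * G i k))
    (hd : d = (1 / 2 : ℝ) • (v ᵥ* Φ) + (c - s / 12) • t) :
    ∑ k, v k • E k = (2 * (t ⬝ᵥ v)) • Φ := by
  ext i j
  rw [sum_smul_apply hEk, Q.dotProduct_inv_mulVec hv, ← dotProduct_mulVec]
  have h1 : t ⬝ᵥ C i j *ᵥ v = 0 := by
    conv_lhs => rw [← Q.dotProduct_inv_mulVec hv]
    rw [dotProduct_comm, dotProduct_mulVec_comm Q.symm,
      dotProduct_mulVec_skew_self Q.symm (skewC i j)]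
  have h2 : Φ *ᵥ v = -(v ᵥ* Φ) := by rw [← mulVec_transpose, hΦT, neg_mulVec, neg_neg]
  rw [h1, hd, hT]
  simp only [add_mulVec, smul_mulVec, vecMulVec_mulVec, Q.dotProduct_inv_mulVec hv, h2,
    Pi.add_apply, Pi.smul_apply, Pi.neg_apply, smul_eq_mul, Matrix.smul_apply, op_smul_eq_smul]
  ring

/-- K is the wedge of θ and Ψθ as an endomorphism. Ψ commutes with the triple and the rank-one
projection twists to a multiple of the identity, so K twists to 2|θ|²Ψ; `skew_decomp` supplies the
rest. Thus the self-dual part of K is ½|θ|²Ψ. -/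
theorem four_smul_twist (Q : IsQuaternionic G J₁ J₂ J₃) (hv : v = G⁻¹ *ᵥ t) {Ψ : Mat}
    (hΨ : G * Ψ = -(Ψᵀ * G)) (h₁ : Ψ * J₁ = J₁ * Ψ) (h₂ : Ψ * J₂ = J₂ * Ψ)
    (h₃ : Ψ * J₃ = J₃ * Ψ) {K : Mat} (hK : K = Ψ * vecMulVec v t + vecMulVec v t * Ψ) :
    (4 : ℝ) • K = (2 * (t ⬝ᵥ v)) • Ψ
      - ((K * J₁).trace • J₁ + (K * J₂).trace • J₂ + (K * J₃).trace • J₃) := by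
  have hN : G * vecMulVec v t = (vecMulVec v t)ᵀ * G := by
    rw [mul_vecMulVec, Q.dotProduct_inv_mulVec hv, transpose_vecMulVec, vecMulVec_mul,
      Q.vecMul_of_eq hv]
  have hKs : G * K = -(Kᵀ * G) := by
    rw [hK, mul_add, mul_assoc_of_eq hΨ, mul_assoc_of_eq hN, neg_mul, mul_assoc, mul_assoc, hN, hΨ,
      transpose_add, transpose_mul, transpose_mul, add_mul, mul_assoc, mul_assoc, mul_neg]
    abel
  have hKc : K - J₁ * K * J₁ - J₂ * K * J₂ - J₃ * K * J₃ = (2 * (t ⬝ᵥ v)) • Ψ := by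
    have e := Q.vecMulVec_sub_conj hv
    have e1 := congrArg (fun A => Ψ * A) e
    have e2 := congrArg (fun A => A * Ψ) e
    simp only [mul_sub, sub_mul, Matrix.mul_smul, Matrix.smul_mul, mul_one, one_mul,
      mul_assoc] at e1 e2
    rw [← mul_assoc Ψ J₁, ← mul_assoc Ψ J₂, ← mul_assoc Ψ J₃, h₁, h₂, h₃] at e1
    rw [← h₁, ← h₂, ← h₃] at e2
    have e3 := congrArg₂ (· + ·) e1 e2
    rw [two_mul, add_smul, ← e3, hK]
    noncomm_ring
  rw [← hKc, sub_eq_add_neg, ← Q.skew_decomp hKs]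
  module

/-- Contract `hEk` with Ψθ. The splitting of K rewrites both the curvature term and the Φ terms, and
the multiples of s times θ∧Ψθ, from the anti-self-dual curvature and from d, cancel. -/
theorem weyl_identity (Q : IsQuaternionic G J₁ J₂ J₃) (hv : v = G⁻¹ *ᵥ t)
    (skewC : ∀ i j, G * C i j = -((C i j)ᵀ * G))
    (tr₁ : ∀ i j, (J₁ * C i j).trace = s / 6 * (J₁ᵀ * G) i j)
    (tr₂ : ∀ i j, (J₂ * C i j).trace = s / 6 * (J₂ᵀ * G) i j)
    (tr₃ : ∀ i j, (J₃ * C i j).trace = s / 6 * (J₃ᵀ * G) i j)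
    (hΦT : Φᵀ = -Φ) (hΦ₁ : Φ * J₁ = -(J₁ᵀ * Φ)) (hΦ₂ : Φ * J₂ = -(J₂ᵀ * Φ))
    (hΦ₃ : Φ * J₃ = -(J₃ᵀ * Φ))
    (hT : T = (1 / 2 : ℝ) • Φ + vecMulVec t t + c • G)
    (hEk : ∀ i j k, E k i j = 2 * (t ᵥ* C i j) k + 2 * (Φ i j * t k)
      + 2 * (t j * T i k - t i * T j k) + 2 * (d i * G j k - d j * G i k))
    (hd : d = (1 / 2 : ℝ) • (v ᵥ* Φ) + (c - s / 12) • t)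
    {ψ Ψ : Mat} (hψ : ψᵀ = -ψ) (hΨ : Ψ = toEndo G ψ) (h₁ : Ψ * J₁ = J₁ * Ψ)
    (h₂ : Ψ * J₂ = J₂ * Ψ) (h₃ : Ψ * J₃ = J₃ * Ψ) (i j : Fin 4) :
    (∑ k, (Ψ *ᵥ v) k • E k) i j = (t ⬝ᵥ v) * (1 / 2 * (Ψ * C i j).trace - s / 12 * ψ i j)
      - 1 / 2 * ((t ⬝ᵥ v) * bracket G ψ Φ i j) := by
  have hGΨ : G * Ψ = -ψ := by
    rw [hΨ, toEndo_eq_neg Q.symm hψ, mul_neg, ← mul_assoc, Q.mul_inv, one_mul]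
  have hΨG : Ψᵀ * G = ψ := by
    have := congrArg transpose hGΨ
    rwa [transpose_mul, Q.symm, transpose_neg, hψ, neg_neg] at this
  have hΨs : G * Ψ = -(Ψᵀ * G) := by rw [hGΨ, hΨG]
  obtain ⟨X, hX⟩ : ∃ X, X = Ψ *ᵥ v := ⟨_, rfl⟩
  obtain ⟨x, hx⟩ : ∃ x, x = G *ᵥ X := ⟨_, rfl⟩
  have htΨ : t ᵥ* Ψ = -x := by
    rw [hx, hX, Q.mulVec_mulVec_skew hv hΨs, neg_neg]
  obtain ⟨K, hK⟩ : ∃ K, K = Ψ * vecMulVec v t + vecMulVec v t * Ψ := ⟨_, rfl⟩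
  have hK4 := Q.four_smul_twist hv hΨs h₁ h₂ h₃ hK
  have hK' : K = vecMulVec X t - vecMulVec v x := by
    rw [hK, mul_vecMulVec, vecMulVec_mul, htΨ, vecMulVec_neg, hX, sub_eq_add_neg]
  have htX : t ⬝ᵥ X = 0 := by
    rw [← Q.dotProduct_inv_mulVec hv, dotProduct_comm, dotProduct_mulVec_comm Q.symm, hX,
      dotProduct_mulVec_skew_self Q.symm hΨs]
  have hCK : (C i j * K).trace = 2 * ((t ᵥ* C i j) ⬝ᵥ X) := by
    rw [hK', mul_sub, mul_vecMulVec, mul_vecMulVec, trace_sub, trace_vecMulVec, trace_vecMulVec,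
      hx, dotProduct_mulVec_skew (skewC i j), dotProduct_mulVec_comm Q.symm v,
      Q.dotProduct_inv_mulVec hv, ← dotProduct_mulVec, dotProduct_comm t]
    ring
  -- The anti-self-dual components of K need not be computed: the curvature is the same scalar on
  -- all three, and `hK4` read as an identity of forms (`e2`) eliminates their sum.
  have hC4 : 4 * (C i j * K).trace = (2 * (t ⬝ᵥ v)) * (Ψ * C i j).trace
      - s / 6 * ((2 * (t ⬝ᵥ v)) * ψ i j - 4 * (t i * x j - x i * t j)) := by
    have e1 := congrArg (fun A => (C i j * A).trace) hK4
    have e2 := congrArg (fun A => (Aᵀ * G) i j) hK4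
    simp only [Matrix.mul_smul, mul_sub, mul_add, trace_smul, trace_sub, trace_add, smul_eq_mul,
      trace_mul_comm (C i j) J₁, trace_mul_comm (C i j) J₂, trace_mul_comm (C i j) J₃,
      trace_mul_comm (C i j) Ψ, tr₁, tr₂, tr₃] at e1
    simp only [transpose_sub, transpose_add, transpose_smul, sub_mul, add_mul, Matrix.smul_mul,
      Matrix.sub_apply, Matrix.add_apply, Matrix.smul_apply, smul_eq_mul, hΨG] at e2
    have e3 : (Kᵀ * G) i j = t i * x j - x i * t j := by
      rw [hK', transpose_sub, transpose_vecMulVec, transpose_vecMulVec, sub_mul, vecMulVec_mul,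
        vecMulVec_mul, Q.vecMul_of_eq hv, ← mulVec_transpose, Q.symm, ← hx, Matrix.sub_apply,
        vecMulVec_apply, vecMulVec_apply]
    rw [e3] at e2
    rw [e1]
    linear_combination (-(s / 6)) * e2
  -- Φ commutes with the triple, so only the self-dual part of K contributes to its commutator with
  -- Φ, giving |θ|²[Ψ, R] = 2[K, R].
  have hB : (t ⬝ᵥ v) * bracket G ψ Φ i j = -2 * (t j * (Φ *ᵥ X) i - t i * (Φ *ᵥ X) j
      + (v ᵥ* Φ) i * x j - (v ᵥ* Φ) j * x i) := by
    obtain ⟨R, hR⟩ : ∃ R, R = toEndo G Φ := ⟨_, rfl⟩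
    have hR' : R = -(G⁻¹ * Φ) := by rw [hR, toEndo_eq_neg Q.symm hΦT]
    have r : ∀ {J : Mat}, G * J = -(Jᵀ * G) → Φ * J = -(Jᵀ * Φ) → J * R = R * J := by
      intro J hJ hJ'
      rw [hR', neg_mul, mul_neg, Q.inv_mul_commute hJ hJ']
    have e : (t ⬝ᵥ v) • (Ψ * R - R * Ψ) = (2 : ℝ) • (K * R - R * K) := by
      have e1 := congrArg (fun A => (1 / 2 : ℝ) • (A * R - R * A)) hK4
      simp only [sub_mul, mul_sub, add_mul, mul_add, Matrix.smul_mul, Matrix.mul_smul,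
        r Q.skew₁ hΦ₁,
        r Q.skew₂ hΦ₂, r Q.skew₃ hΦ₃] at e1
      rw [← sub_eq_zero] at e1 ⊢
      rw [← neg_eq_zero, ← e1]
      module
    have e2 := congrArg (fun A => (Aᵀ * G) i j) e
    simp only [transpose_smul, Matrix.smul_mul, Matrix.smul_apply, smul_eq_mul] at e2
    rw [bracket, toForm_eq, ← hΨ, ← hR, e2, hK']
    have hGR : G * R = -Φ := by rw [hR', mul_neg, ← mul_assoc, Q.mul_inv, one_mul]
    have g₁ : t ᵥ* R = -(v ᵥ* Φ) := by
      rw [← Q.vecMul_of_eq hv, vecMul_vecMul, hGR, vecMul_neg]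
    have g₂ : x ᵥ* R = Φ *ᵥ X := by
      rw [hx, ← vecMul_transpose, Q.symm, vecMul_vecMul, hGR, ← hΦT, vecMul_transpose]
    have g : ∀ y, (R *ᵥ y) ᵥ* G = -(Φ *ᵥ y) := by
      intro y
      rw [← mulVec_transpose, Q.symm, mulVec_mulVec, hGR, neg_mulVec]
    have g₃ : Φ *ᵥ v = -(v ᵥ* Φ) := by rw [← mulVec_transpose, hΦT, neg_mulVec, neg_neg]
    have g₄ : X ᵥ* G = x := by rw [← mulVec_transpose, Q.symm, hx]
    simp only [sub_mul, mul_sub, vecMulVec_mul, mul_vecMulVec, transpose_sub, transpose_vecMulVec,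
      g₁, g₂, g, g₃, g₄, Q.vecMul_of_eq hv, Matrix.sub_apply, vecMulVec_apply, Pi.neg_apply]
    ring
  rw [← hX, sum_smul_apply hEk, htX, ← hx]
  have hTX : T *ᵥ X = (1 / 2 : ℝ) • (Φ *ᵥ X) + c • x := by
    rw [hT, add_mulVec, add_mulVec, smul_mulVec, smul_mulVec, vecMulVec_mulVec, htX, ← hx]
    simp
  rw [hTX, hB, hd]
  rw [hCK] at hC4
  simp only [Pi.add_apply, Pi.smul_apply, smul_eq_mul]
  linear_combination (1 / 4) * hC4

end IsQuaternionic

/-! ### The Weyl operator, and covariant derivatives of forms. -/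

theorem raise_neg (G ψ : Mat) : raise G (-ψ) = -raise G ψ := by simp [raise_eq]

theorem weylOp_neg (G : E4 → Mat) (u : E4) (ψ : Mat) : weylOp G u (-ψ) = -weylOp G u ψ := by
  ext k l
  simp [weylOp, raise_neg]

/-- The covariant derivative of a 1-form: `(covOne G t u) i k = (D_{∂ᵢ} t)(∂ₖ)`. -/
noncomputable def covOne (G : E4 → Mat) (t : E4 → Fin 4 → ℝ) (u : E4) : Mat :=
  Matrix.of fun i k => pd i (fun v => t v k) u - (t u ᵥ* connMat G i u) k

/-- The matrix all of whose rows are the components of the 1-form `t`. -/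
def rowMat (t : E4 → Fin 4 → ℝ) (u : E4) : Mat := Matrix.of fun _ k => t u k

theorem transpose_dOne (t : E4 → Fin 4 → ℝ) (u : E4) : (dOne t u)ᵀ = -dOne t u := by
  ext i j
  simp [dOne]

theorem normSq_eq (G : Mat) (t : Fin 4 → ℝ) : normSq G t = t ⬝ᵥ G⁻¹ *ᵥ t :=
  dotProduct_comm _ _

namespace IsLocalMetric

variable {U : Set E4} {G : E4 → Mat} {u : E4}

/-- For an Einstein metric only the scalar correction survives, and pair symmetry moves ψ from the
form indices of the curvature to its endomorphism indices. -/
theorem weylOp_eq (hG : IsLocalMetric U G) (hu : u ∈ U) (hE : ricci₀ G u = 0) {ψ : Mat}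
    (hψ : ψᵀ = -ψ) (k l : Fin 4) :
    weylOp G u ψ k l = 1 / 2 * (toEndo (G u) ψ * curvMat G k l u).trace
      - scal G u / 12 * ψ k l := by
  have hs : ((G u)⁻¹)ᵀ = (G u)⁻¹ := by rw [transpose_nonsing_inv, hG.symm u hu]
  have h1 : G u * raise (G u) ψ * G u = ψ := by
    rw [raise_eq, hs, mul_assoc, mul_assoc, hG.inv_mul hu, mul_one, ← mul_assoc, hG.mul_inv hu,
      one_mul]
  have h2 : (raise (G u) ψ)ᵀ * G u = toEndo (G u) ψ := by
    rw [transpose_raise hψ, toEndo_eq_neg (hG.symm u hu) hψ, raise_eq, hs, neg_mul, mul_assoc,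
      hG.inv_mul hu, mul_one]
  have h3 : ∀ k l, ∑ i, ∑ j, raise (G u) ψ i j * (G u i k * G u j l) = ψ k l := by
    intro k l
    conv_rhs => rw [← h1]
    simp only [Matrix.mul_apply, Finset.sum_mul]
    rw [Finset.sum_comm]
    refine Finset.sum_congr rfl fun i _ => Finset.sum_congr rfl fun j _ => ?_
    rw [← transpose_apply (G u) k, hG.symm u hu]
    ring
  have h4 : ψ l k = -ψ k l := by rw [← transpose_apply ψ, hψ, Matrix.neg_apply]
  have h5 : ∑ i, ∑ j, raise (G u) ψ i j * (G u * curvMat G k l u) i j =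
      (toEndo (G u) ψ * curvMat G k l u).trace := by
    rw [← trace_transpose_mul_eq_sum, ← mul_assoc, h2]
  have h6 : ∀ i j, weyl G u i j k l = (G u * curvMat G k l u) i j
      - scal G u / 12 * (G u i k * G u j l - G u i l * G u j k) := by
    intro i j
    rw [weyl, hE, hG.riemannLow_pair hu, hG.riemannLow_eq hu]
    simp
  have h7 : weylOp G u ψ k l = 1 / 2 * (∑ i, ∑ j, raise (G u) ψ i j * (G u * curvMat G k l u) i j
      - scal G u / 12 * (∑ i, ∑ j, raise (G u) ψ i j * (G u i k * G u j l)
        - ∑ i, ∑ j, raise (G u) ψ i j * (G u i l * G u j k))) := by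
    simp only [weylOp, of_apply, h6, Finset.mul_sum, ← Finset.sum_sub_distrib]
    refine Finset.sum_congr rfl fun i _ => Finset.sum_congr rfl fun j _ => by ring
  rw [h7, h3, h3, h5, h4]
  ring

/-- On the anti-self-dual forms, the curvature of a self-dual Einstein metric is scalar. -/
theorem trace_mul_curvMat (hG : IsLocalMetric U G) (hu : u ∈ U) (hE : ricci₀ G u = 0)
    (hW : ∀ ψ : Mat, ψᵀ = -ψ → weylMinus G u ψ = 0) {J : Mat}
    (hJ : IsAntiSelfDualForm (G u) (Jᵀ * G u)) (i j : Fin 4) :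
    (J * curvMat G i j u).trace = scal G u / 6 * (Jᵀ * G u) i j := by
  have h1 := congrFun (congrFun (hW _ hJ.1) i) j
  rw [weylMinus, hJ.2, weylOp_neg, sub_neg_eq_add, Matrix.smul_apply, Matrix.add_apply,
    hG.weylOp_eq hu hE hJ.1, toEndo_eq, mul_assoc, hG.mul_inv hu, mul_one, transpose_transpose,
    smul_eq_mul, Matrix.zero_apply] at h1
  linarith

theorem vecMul_connMat_symm (hG : IsLocalMetric U G) (hu : u ∈ U) (x : Fin 4 → ℝ) (i j : Fin 4) :
    (x ᵥ* connMat G i u) j = (x ᵥ* connMat G j u) i := by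
  simp only [vecMul, dotProduct]
  exact Finset.sum_congr rfl fun m _ => by rw [hG.connMat_symm hu]

theorem covEndo_congr (hG : IsLocalMetric U G) (hu : u ∈ U) {A B : E4 → Mat}
    (h : ∀ v ∈ U, A v = B v) (i : Fin 4) : covEndo G i A u = covEndo G i B u := by
  rw [covEndo, covEndo, pdMat_congr hG.isOpen hu h, h u hu]

theorem covForm_congr (hG : IsLocalMetric U G) (hu : u ∈ U) {A B : E4 → Mat}
    (h : ∀ v ∈ U, A v = B v) (i : Fin 4) : covForm G i A u = covForm G i B u := by
  rw [covForm, covForm, pdMat_congr hG.isOpen hu h, h u hu]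

theorem covEndo_smul_sub (hG : IsLocalMetric U G) (hu : u ∈ U) {A B : E4 → Mat} {f h : E4 → ℝ}
    (hA : SmoothMat U A) (hB : SmoothMat U B) (hf : ContDiffOn ℝ ∞ f U)
    (hh : ContDiffOn ℝ ∞ h U) (i : Fin 4) :
    covEndo G i (fun v => f v • A v - h v • B v) u = pd i f u • A u + f u • covEndo G i A u
      - (pd i h u • B u + h u • covEndo G i B u) := by
  rw [covEndo, pdMat_sub hG.isOpen hu (hA.smul hf) (hB.smul hh), pdMat_smul hG.isOpen hu hf hA,
    pdMat_smul hG.isOpen hu hh hB]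
  simp only [covEndo, mul_sub, sub_mul, Matrix.mul_smul, Matrix.smul_mul]
  module

theorem covForm_mul (hG : IsLocalMetric U G) (hu : u ∈ U) {A B : E4 → Mat}
    (hA : SmoothMat U A) (hB : SmoothMat U B) (i : Fin 4) :
    covForm G i (fun v => A v * B v) u = covForm G i A u * B u + A u * covEndo G i B u := by
  simp only [covForm, covEndo, pdMat_mul hG.isOpen hu hA hB]
  noncomm_ring

theorem covForm_transpose_mul' (hG : IsLocalMetric U G) (hu : u ∈ U) {A B : E4 → Mat}
    (hA : SmoothMat U A) (hB : SmoothMat U B) (i : Fin 4) :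
    covForm G i (fun v => (B v)ᵀ * A v) u =
      (covEndo G i B u)ᵀ * A u + (B u)ᵀ * covForm G i A u := by
  simp only [covForm, covEndo, pdMat_mul hG.isOpen hu hB.transpose hA, pdMat_transpose,
    transpose_sub, transpose_add, transpose_mul]
  noncomm_ring

theorem covForm_add (hG : IsLocalMetric U G) (hu : u ∈ U) {A B : E4 → Mat}
    (hA : SmoothMat U A) (hB : SmoothMat U B) (i : Fin 4) :
    covForm G i (fun v => A v + B v) u = covForm G i A u + covForm G i B u := by
  simp only [covForm, pdMat_add hG.isOpen hu hA hB]
  noncomm_ring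

theorem covForm_smul (hG : IsLocalMetric U G) (hu : u ∈ U) {A : E4 → Mat} {f : E4 → ℝ}
    (hf : ContDiffOn ℝ ∞ f U) (hA : SmoothMat U A) (i : Fin 4) :
    covForm G i (fun v => f v • A v) u = pd i f u • A u + f u • covForm G i A u := by
  simp only [covForm, pdMat_smul hG.isOpen hu hf hA, Matrix.mul_smul, Matrix.smul_mul]
  module

theorem covForm_metric (hG : IsLocalMetric U G) (hu : u ∈ U) (i : Fin 4) :
    covForm G i G u = 0 := by
  rw [covForm, hG.pdMat_metric hu]
  abel

section OneForm

variable {t : E4 → Fin 4 → ℝ}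

theorem smooth_rowMat (ht : ∀ k, ContDiffOn ℝ ∞ (fun u => t u k) U) : SmoothMat U (rowMat t) :=
  fun _ k => ht k

theorem smooth_dOne (hU : IsOpen U) (ht : ∀ k, ContDiffOn ℝ ∞ (fun u => t u k) U) :
    SmoothMat U (dOne t) := fun i j =>
  (contDiffOn_pd hU (ht j) i).sub (contDiffOn_pd hU (ht i) j)

theorem smooth_scal (hG : IsLocalMetric U G) : ContDiffOn ℝ ∞ (scal G) U := by
  unfold scal
  refine ContDiffOn.sum fun i _ => ContDiffOn.sum fun k _ => (hG.smooth_inv i k).mul ?_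
  simp only [ricci, of_apply, riemann_eq_curvMat]
  exact ContDiffOn.sum fun j _ => (hG.smooth_curvMat i j j k).neg

theorem smooth_normSq (hG : IsLocalMetric U G) (ht : ∀ k, ContDiffOn ℝ ∞ (fun u => t u k) U) :
    ContDiffOn ℝ ∞ (fun u => normSq (G u) (t u)) U := by
  unfold normSq sharp
  exact ContDiffOn.sum fun a _ =>
    (ContDiffOn.sum fun b _ => (hG.smooth_inv a b).mul (ht b)).mul (ht a)

/-- The Levi-Civita connection is torsion-free. -/
theorem dOne_eq (hG : IsLocalMetric U G) (hu : u ∈ U) :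
    dOne t u = covOne G t u - (covOne G t u)ᵀ := by
  ext i j
  have := hG.vecMul_connMat_symm hu (t u) i j
  simp only [dOne, covOne, of_apply, Matrix.sub_apply, transpose_apply, this]
  ring

theorem pd_vecMul (hG : IsLocalMetric U G) (hu : u ∈ U)
    (ht : ∀ k, ContDiffOn ℝ ∞ (fun u => t u k) U) {A : E4 → Mat} (hA : SmoothMat U A)
    (i j : Fin 4) : pd i (fun v => (t v ᵥ* A v) j) u = (covOne G t u * A u) i j
      + (t u ᵥ* covEndo G i A u) j + ((t u ᵥ* A u) ᵥ* connMat G i u) j := by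
  have h := congrFun (congrFun (pdMat_mul hG.isOpen hu (smooth_rowMat ht) hA i) 0) j
  have e : (pdMat i (rowMat t) u * A u + rowMat t u * pdMat i A u) =
      covRow G i (rowMat t) u * A u + rowMat t u * covEndo G i A u
        + rowMat t u * A u * connMat G i u := by
    simp only [covRow, covEndo]
    noncomm_ring
  rw [e] at h
  exact h

theorem d_vecMul (hG : IsLocalMetric U G) (hu : u ∈ U)
    (ht : ∀ k, ContDiffOn ℝ ∞ (fun u => t u k) U) {A : E4 → Mat} (hA : SmoothMat U A)
    (i j : Fin 4) :
    pd i (fun v => (t v ᵥ* A v) j) u - pd j (fun v => (t v ᵥ* A v) i) u =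
      (covOne G t u * A u) i j - (covOne G t u * A u) j i
      + ((t u ᵥ* covEndo G i A u) j - (t u ᵥ* covEndo G j A u) i) := by
  have := hG.vecMul_connMat_symm hu (t u ᵥ* A u) i j
  rw [hG.pd_vecMul hu ht hA, hG.pd_vecMul hu ht hA, this]
  ring

/-- The Ricci identity for 1-forms. -/
theorem covForm_covOne_sub (hG : IsLocalMetric U G) (hu : u ∈ U)
    (ht : ∀ k, ContDiffOn ℝ ∞ (fun u => t u k) U) (i j k : Fin 4) :
    covForm G i (covOne G t) u j k - covForm G j (covOne G t) u i k =
      -(t u ᵥ* curvMat G i j u) k := by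
  have h := congrFun (congrFun (hG.covRow_comm hu (smooth_rowMat ht) i j) 0) k
  -- `covRow` treats the index of the inner derivative as a mere label; the missing Christoffel term
  -- is symmetric in i and j, so it drops from the difference.
  have e : ∀ a b, covRow G a (covRow G b (rowMat t)) u 0 k = covForm G a (covOne G t) u b k
      + ((connMat G a u)ᵀ * covOne G t u) b k := by
    intro a b
    have e1 : covRow G a (covRow G b (rowMat t)) u 0 k =
        pd a (fun v => covOne G t v b k) u - (covOne G t u * connMat G a u) b k := rfl
    rw [e1, covForm, Matrix.sub_apply, Matrix.sub_apply]
    simp only [pdMat, of_apply]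
    ring
  have s : ((connMat G i u)ᵀ * covOne G t u) j k = ((connMat G j u)ᵀ * covOne G t u) i k := by
    simp only [Matrix.mul_apply, transpose_apply]
    exact Finset.sum_congr rfl fun m _ => by rw [hG.connMat_symm hu]
  rw [Matrix.sub_apply, e, e, s] at h
  have h' : (-(rowMat t u * curvMat G i j u)) 0 k = -(t u ᵥ* curvMat G i j u) k := rfl
  linarith

theorem dTwo_dOne (hU : IsOpen U) (hu : u ∈ U)
    (ht : ∀ k, ContDiffOn ℝ ∞ (fun u => t u k) U) (i j k : Fin 4) : dTwo (dOne t) u i j k = 0 := by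
  have e : ∀ a b c, pd a (fun v => dOne t v b c) u =
      pd a (pd b fun v => t v c) u - pd a (pd c fun v => t v b) u := fun a b c =>
    pd_sub (differentiableAt_of_contDiffOn hU (contDiffOn_pd hU (ht c) b) hu)
      (differentiableAt_of_contDiffOn hU (contDiffOn_pd hU (ht b) c) hu) a
  rw [dTwo, e, e, e, pd_comm hU (ht k) hu i j, pd_comm hU (ht i) hu j k, pd_comm hU (ht j) hu k i]
  ring

theorem pd_normSq (hG : IsLocalMetric U G) (hu : u ∈ U)
    (ht : ∀ k, ContDiffOn ℝ ∞ (fun u => t u k) U) (i : Fin 4) :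
    pd i (fun v => normSq (G v) (t v)) u = 2 * (covOne G t u *ᵥ ((G u)⁻¹ *ᵥ t u)) i := by
  have hr := smooth_rowMat ht
  have e0 : (fun v => normSq (G v) (t v)) =
      fun v => (rowMat t v * ((G v)⁻¹ * (rowMat t v)ᵀ)) 0 0 := by
    funext v
    rw [normSq_eq]
    rfl
  have h := congrFun (congrFun (pdMat_mul hG.isOpen hu hr (hG.smooth_inv.mul hr.transpose) i) 0) 0
  rw [pdMat_mul hG.isOpen hu hG.smooth_inv hr.transpose, hG.pdMat_inv hu, pdMat_transpose] at h
  have e : pdMat i (rowMat t) u * ((G u)⁻¹ * (rowMat t u)ᵀ) + rowMat t u *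
      ((-(connMat G i u * (G u)⁻¹) - (G u)⁻¹ * (connMat G i u)ᵀ) * (rowMat t u)ᵀ
        + (G u)⁻¹ * (pdMat i (rowMat t) u)ᵀ) =
      covRow G i (rowMat t) u * ((G u)⁻¹ * (rowMat t u)ᵀ)
        + (covRow G i (rowMat t) u * ((G u)⁻¹ * (rowMat t u)ᵀ))ᵀ := by
    rw [transpose_mul, transpose_mul, transpose_transpose, transpose_nonsing_inv, hG.symm u hu]
    simp only [covRow, transpose_sub, transpose_mul]
    noncomm_ring
  rw [e, Matrix.add_apply, transpose_apply, ← two_mul] at h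
  rw [e0]
  exact h

end OneForm

end IsLocalMetric

/-! ### Triples parallel for a Weyl connection. -/

/-- A quaternionic triple on the open set `U`, parallel for the Weyl connection of `G` and of the
1-form `t`. -/
structure IsWeylParallel (U : Set E4) (G J₁ J₂ J₃ : E4 → Mat) (t : E4 → Fin 4 → ℝ) : Prop where
  metric : IsLocalMetric U G
  quat : ∀ u ∈ U, IsQuaternionic (G u) (J₁ u) (J₂ u) (J₃ u)
  smooth₁ : SmoothMat U J₁
  smooth₂ : SmoothMat U J₂
  smooth₃ : SmoothMat U J₃
  smooth_form : ∀ k, ContDiffOn ℝ ∞ (fun u => t u k) U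
  cov₁ : ∀ u ∈ U, ∀ i, covEndo G i J₁ u = (t u ᵥ* J₃ u) i • J₂ u - (t u ᵥ* J₂ u) i • J₃ u
  cov₂ : ∀ u ∈ U, ∀ i, covEndo G i J₂ u = (t u ᵥ* J₁ u) i • J₃ u - (t u ᵥ* J₃ u) i • J₁ u
  cov₃ : ∀ u ∈ U, ∀ i, covEndo G i J₃ u = (t u ᵥ* J₂ u) i • J₁ u - (t u ᵥ* J₁ u) i • J₂ u

namespace IsWeylParallel

variable {U : Set E4} {G J₁ J₂ J₃ : E4 → Mat} {t : E4 → Fin 4 → ℝ} {u : E4}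

theorem rotate (H : IsWeylParallel U G J₁ J₂ J₃ t) : IsWeylParallel U G J₂ J₃ J₁ t :=
  ⟨H.metric, fun u hu => (H.quat u hu).rotate, H.smooth₂, H.smooth₃, H.smooth₁, H.smooth_form,
    H.cov₂, H.cov₃, H.cov₁⟩

theorem smooth_vecMul (H : IsWeylParallel U G J₁ J₂ J₃ t) {A : E4 → Mat} (hA : SmoothMat U A)
    (j : Fin 4) : ContDiffOn ℝ ∞ (fun v => (t v ᵥ* A v) j) U :=
  ((IsLocalMetric.smooth_rowMat H.smooth_form).mul hA) 0 j

/-- The structure equation for the curvature of the bundle spanned by the triple. -/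
theorem d_connection (H : IsWeylParallel U G J₁ J₂ J₃ t) (hu : u ∈ U) (i j : Fin 4) :
    pd i (fun v => (t v ᵥ* J₃ v) j) u - pd j (fun v => (t v ᵥ* J₃ v) i) u
      + ((t u ᵥ* J₁ u) i * (t u ᵥ* J₂ u) j - (t u ᵥ* J₁ u) j * (t u ᵥ* J₂ u) i) =
      -(1 / 2) * (J₃ u * curvMat G i j u).trace := by
  have Q := H.quat u hu
  -- Tracing against J₂ isolates the J₂ coefficient of the second derivative of J₁: tr J₂² = −4,
  -- while J₁J₂ and J₃J₂ are trace-free.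
  have e : ∀ a b, (covEndo G a (covEndo G b J₁) u * J₂ u).trace =
      -4 * (pd a (fun v => (t v ᵥ* J₃ v) b) u + (t u ᵥ* J₁ u) a * (t u ᵥ* J₂ u) b) := by
    intro a b
    have t₂ : (J₂ u * J₂ u).trace = -4 := by
      rw [Q.mul₂₂, trace_neg, trace_one]; norm_num
    have t₃ : (J₃ u * J₂ u).trace = 0 := by
      rw [Q.mul₃₂, trace_neg, Q.trace_eq_zero, neg_zero]
    have t₁ : (J₁ u * J₂ u).trace = 0 := by
      rw [Q.mul₁₂, Q.rotate.rotate.trace_eq_zero]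
    rw [H.metric.covEndo_congr hu (fun v hv => H.cov₁ v hv b),
      H.metric.covEndo_smul_sub hu H.smooth₂ H.smooth₃ (H.smooth_vecMul H.smooth₃ b)
        (H.smooth_vecMul H.smooth₂ b), H.cov₂ u hu, H.cov₃ u hu]
    simp only [sub_mul, add_mul, smul_sub, Matrix.smul_mul, trace_add, trace_sub, trace_smul, t₁,
      t₂, t₃, smul_eq_mul]
    ring
  have h := congrArg (fun A => (A * J₂ u).trace) (H.metric.covEndo_comm hu H.smooth₁ i j)
  simp only [sub_mul, trace_sub, e] at h
  have c₁ : (curvMat G i j u * J₁ u * J₂ u).trace = (J₃ u * curvMat G i j u).trace := by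
    rw [mul_assoc, Q.mul₁₂, trace_mul_comm]
  have c₂ : (J₁ u * curvMat G i j u * J₂ u).trace = -(J₃ u * curvMat G i j u).trace := by
    rw [trace_mul_comm, ← mul_assoc, Q.mul₂₁, neg_mul, trace_neg]
  rw [c₁, c₂] at h
  linarith

/-- Expand d(θ∘J₃) in `d_connection` by the Leibniz rule. The quadratic terms combine through
`vecMul_wedge`, which contributes the |θ|² multiple of the Kähler form. -/
theorem covOne_mul_sub (H : IsWeylParallel U G J₁ J₂ J₃ t) (hu : u ∈ U) {s : ℝ}
    (hC : ∀ i j, (J₃ u * curvMat G i j u).trace = s / 6 * ((J₃ u)ᵀ * G u) i j) :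
    covOne G t u * J₃ u - (covOne G t u * J₃ u)ᵀ = vecMulVec (t u) (t u ᵥ* J₃ u)
      - vecMulVec (t u ᵥ* J₃ u) (t u) + (normSq (G u) (t u) - s / 12) • ((J₃ u)ᵀ * G u) := by
  have Q := H.quat u hu
  ext i j
  have h1 := H.d_connection hu i j
  rw [H.metric.d_vecMul hu H.smooth_form H.smooth₃, H.cov₃ u hu, H.cov₃ u hu, hC] at h1
  have h2 := congrFun (congrFun (Q.vecMul_wedge (t := t u) rfl) i) j
  rw [← normSq_eq] at h2
  simp only [vecMul_sub, vecMul_smul, Pi.sub_apply, Pi.smul_apply, smul_eq_mul] at h1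
  simp only [Matrix.sub_apply, Matrix.add_apply, Matrix.smul_apply, vecMulVec_apply,
    smul_eq_mul, transpose_apply] at h2 ⊢
  linarith

/-- The curvature hypotheses at a point: on the span of the triple, the curvature is scalar. -/
def IsScalarCurv (G J₁ J₂ J₃ : E4 → Mat) (s : E4 → ℝ) (u : E4) : Prop :=
  ∀ i j, (J₁ u * curvMat G i j u).trace = s u / 6 * ((J₁ u)ᵀ * G u) i j ∧
    (J₂ u * curvMat G i j u).trace = s u / 6 * ((J₂ u)ᵀ * G u) i j ∧
    (J₃ u * curvMat G i j u).trace = s u / 6 * ((J₃ u)ᵀ * G u) i j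

/-- Subtracting θ⊗θ and c g from Dθ leaves S with every S J symmetric; c is chosen so that −2c =
|θ|² − s/12. By `form_decomp`, S is skew and commutes with the triple, and being the skew part of Dθ
it is ½Φ. -/
theorem covOne_eq (H : IsWeylParallel U G J₁ J₂ J₃ t) (hu : u ∈ U) {s : E4 → ℝ}
    (hC : IsScalarCurv G J₁ J₂ J₃ s u) :
    covOne G t u = (1 / 2 : ℝ) • dOne t u + vecMulVec (t u) (t u)
        + (1 / 2 * (s u / 12 - normSq (G u) (t u))) • G u ∧
      dOne t u * J₁ u = -((J₁ u)ᵀ * dOne t u) ∧ dOne t u * J₂ u = -((J₂ u)ᵀ * dOne t u) ∧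
      dOne t u * J₃ u = -((J₃ u)ᵀ * dOne t u) := by
  have Q := H.quat u hu
  obtain ⟨S, hS⟩ : ∃ S, S = covOne G t u - vecMulVec (t u) (t u)
      - (1 / 2 * (s u / 12 - normSq (G u) (t u))) • G u := ⟨_, rfl⟩
  have h : ∀ {J : Mat}, G u * J = -(Jᵀ * G u) → covOne G t u * J - (covOne G t u * J)ᵀ =
      vecMulVec (t u) (t u ᵥ* J) - vecMulVec (t u ᵥ* J) (t u)
        + (normSq (G u) (t u) - s u / 12) • (Jᵀ * G u) → S * J = (S * J)ᵀ := by
    intro J hJ h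
    rw [← sub_eq_zero] at h ⊢
    rw [← h, hS]
    simp only [sub_mul, transpose_sub, Matrix.smul_mul, transpose_smul, vecMulVec_mul,
      transpose_vecMulVec, hJ, transpose_neg, transpose_mul, transpose_transpose, Q.symm]
    module
  obtain ⟨hT, e₁, e₂, e₃⟩ := Q.form_decomp
    (h Q.skew₁ (H.rotate.covOne_mul_sub hu fun i j => (hC i j).1))
    (h Q.skew₂ (H.rotate.rotate.covOne_mul_sub hu fun i j => (hC i j).2.1))
    (h Q.skew₃ (H.covOne_mul_sub hu fun i j => (hC i j).2.2))
  have hd : dOne t u = (2 : ℝ) • S := by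
    have e : covOne G t u - (covOne G t u)ᵀ = S - Sᵀ := by
      rw [hS]
      simp only [transpose_sub, transpose_smul, transpose_vecMulVec, Q.symm]
      abel
    rw [H.metric.dOne_eq hu, e, hT, sub_neg_eq_add, two_smul]
  refine ⟨?_, ?_, ?_, ?_⟩
  · rw [hd, hS]; module
  · rw [hd, Matrix.smul_mul, e₁, Matrix.mul_smul, smul_neg]
  · rw [hd, Matrix.smul_mul, e₂, Matrix.mul_smul, smul_neg]
  · rw [hd, Matrix.smul_mul, e₃, Matrix.mul_smul, smul_neg]

variable {s : E4 → ℝ}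

/-- Differentiate the commutation of Φ with J₂: the derivative of J₂ lies in the span of J₁ and J₃,
with which Φ also commutes, so it contributes nothing. -/
theorem covForm_dOne_commute (H : IsWeylParallel U G J₁ J₂ J₃ t)
    (hC : ∀ v ∈ U, IsScalarCurv G J₁ J₂ J₃ s v) (hu : u ∈ U) (k : Fin 4) :
    covForm G k (dOne t) u * J₂ u = -((J₂ u)ᵀ * covForm G k (dOne t) u) := by
  have hd := IsLocalMetric.smooth_dOne H.metric.isOpen H.smooth_form
  have h : covForm G k (fun v => dOne t v * J₂ v + (J₂ v)ᵀ * dOne t v) u = 0 := by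
    rw [H.metric.covForm_congr hu (B := fun _ => 0) (fun v hv => by
      rw [(H.covOne_eq hv (hC v hv)).2.2.1, neg_add_cancel])]
    simp [covForm, pdMat_const]
  rw [H.metric.covForm_add hu (hd.mul H.smooth₂) (H.smooth₂.transpose.mul hd),
    H.metric.covForm_mul hu hd H.smooth₂, H.metric.covForm_transpose_mul' hu hd H.smooth₂,
    H.cov₂ u hu] at h
  obtain ⟨-, e₁, -, e₃⟩ := H.covOne_eq hu (hC u hu)
  simp only [mul_sub, Matrix.mul_smul, e₁, e₃, transpose_sub, transpose_smul, sub_mul,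
    Matrix.smul_mul] at h
  rw [← add_eq_zero_iff_eq_neg, ← h]
  module

/-- Substitute `covOne_eq` into the Ricci identity for θ. This gives the skew part of DΦ in its
first two indices, and dΦ = 0 converts that into the derivative along the third. -/
theorem covForm_dOne_apply (H : IsWeylParallel U G J₁ J₂ J₃ t)
    (hC : ∀ v ∈ U, IsScalarCurv G J₁ J₂ J₃ s v) (hs : ContDiffOn ℝ ∞ s U) (hu : u ∈ U)
    (i j k : Fin 4) :
    covForm G k (dOne t) u i j = 2 * (t u ᵥ* curvMat G i j u) k + 2 * (dOne t u i j * t u k)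
      + 2 * (t u j * covOne G t u i k - t u i * covOne G t u j k)
      + 2 * (pd i (fun v => 1 / 2 * (s v / 12 - normSq (G v) (t v))) u * G u j k
        - pd j (fun v => 1 / 2 * (s v / 12 - normSq (G v) (t v))) u * G u i k) := by
  have hd := IsLocalMetric.smooth_dOne H.metric.isOpen H.smooth_form
  obtain ⟨c, hc⟩ : ∃ c : E4 → ℝ, c = fun v => 1 / 2 * (s v / 12 - normSq (G v) (t v)) := ⟨_, rfl⟩
  have hcs : ContDiffOn ℝ ∞ c U := by
    rw [hc]
    exact contDiffOn_const.mul ((hs.div_const _).sub (H.metric.smooth_normSq H.smooth_form))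
  have hv : SmoothMat U fun v => vecMulVec (t v) (t v) := fun a b =>
    (H.smooth_form a).mul (H.smooth_form b)
  have hT : ∀ v ∈ U, covOne G t v = (1 / 2 : ℝ) • dOne t v + vecMulVec (t v) (t v) + c v • G v :=
    fun v hv => by rw [(H.covOne_eq hv (hC v hv)).1, hc]
  have hcov : ∀ a b, covForm G a (covOne G t) u b k = 1 / 2 * covForm G a (dOne t) u b k
      + (covOne G t u a b * t u k + t u b * covOne G t u a k) + pd a c u * G u b k := by
    intro a b
    have e : covForm G a (fun v => vecMulVec (t v) (t v)) u b k =
        covOne G t u a b * t u k + t u b * covOne G t u a k := by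
      have e1 : pd a (fun v => t v b * t v k) u = pd a (fun v => t v b) u * t u k
          + t u b * pd a (fun v => t v k) u :=
        pd_mul (differentiableAt_of_contDiffOn H.metric.isOpen (H.smooth_form b) hu)
          (differentiableAt_of_contDiffOn H.metric.isOpen (H.smooth_form k) hu) a
      rw [covForm, mul_vecMulVec, vecMulVec_mul, mulVec_transpose]
      simp only [Matrix.sub_apply, pdMat, of_apply, vecMulVec_apply, e1, covOne]
      ring
    rw [H.metric.covForm_congr hu hT, H.metric.covForm_add hu
      ((hd.smul (f := fun _ => 1 / 2) contDiffOn_const).add hv) (H.metric.smooth.smul hcs),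
      H.metric.covForm_add hu (hd.smul (f := fun _ => 1 / 2) contDiffOn_const) hv,
      H.metric.covForm_smul hu contDiffOn_const hd, H.metric.covForm_smul hu hcs H.metric.smooth,
      H.metric.covForm_metric hu, pd_const, Matrix.add_apply, Matrix.add_apply, e]
    simp
  have h1 := H.metric.covForm_covOne_sub hu H.smooth_form i j k
  rw [hcov, hcov] at h1
  have h2 := H.metric.dTwo_eq hu (transpose_dOne t u) i j k
  rw [IsLocalMetric.dTwo_dOne H.metric.isOpen hu H.smooth_form] at h2
  have h3 : covForm G j (dOne t) u k i = -covForm G j (dOne t) u i k := by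
    have : (covForm G j (dOne t) u)ᵀ = -covForm G j (dOne t) u := by
      have e1 : (pdMat j (dOne t) u)ᵀ = -pdMat j (dOne t) u := by
        rw [← pdMat_transpose, ← pdMat_neg]
        exact congrArg (fun A => pdMat j A u) (funext fun v => transpose_dOne t v)
      simp only [covForm, transpose_sub, transpose_mul, transpose_dOne, e1, transpose_transpose]
      noncomm_ring
    rw [← transpose_apply (covForm G j (dOne t) u), this, Matrix.neg_apply]
  have h4 : dOne t u i j = covOne G t u i j - covOne G t u j i := by
    rw [H.metric.dOne_eq hu, Matrix.sub_apply, transpose_apply]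
  rw [h4, ← hc]
  linarith

end IsWeylParallel

namespace IsWeylParallel

variable {U : Set E4} {G J₁ J₂ J₃ : E4 → Mat} {t : E4 → Fin 4 → ℝ} {u : E4}

/-- An integrable triple is parallel for the Weyl connection of the Lee form. -/
theorem of_integrable (hG : IsLocalMetric U G)
    (quat : ∀ u ∈ U, IsQuaternionic (G u) (J₁ u) (J₂ u) (J₃ u))
    (s₁ : SmoothMat U J₁) (s₂ : SmoothMat U J₂) (s₃ : SmoothMat U J₃)
    (ht : ∀ k, ContDiffOn ℝ ∞ (fun u => t u k) U)
    (N₁ : ∀ u ∈ U, ∀ k i j, nijenhuis J₁ u k i j = 0)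
    (N₂ : ∀ u ∈ U, ∀ k i j, nijenhuis J₂ u k i j = 0)
    (lee : ∀ u ∈ U, ∀ i j k, dTwo (fun v => (J₁ v)ᵀ * G v) u i j k =
      -2 * wedge (t u) ((J₁ u)ᵀ * G u) i j k) :
    IsWeylParallel U G J₁ J₂ J₃ t := by
  have cov : ∀ u ∈ U, ∀ i,
      covEndo G i J₁ u = (t u ᵥ* J₃ u) i • J₂ u - (t u ᵥ* J₂ u) i • J₃ u ∧
      covEndo G i J₂ u = (t u ᵥ* J₁ u) i • J₃ u - (t u ᵥ* J₃ u) i • J₁ u ∧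
      covEndo G i J₃ u = (t u ᵥ* J₂ u) i • J₁ u - (t u ᵥ* J₁ u) i • J₂ u := by
    intro u hu
    have Q := quat u hu
    have zero : ∀ {A : E4 → Mat}, ∀ i, (∀ v ∈ U, A v = 0) → pdMat i A u = 0 := fun i h => by
      rw [pdMat_congr hG.isOpen hu h, pdMat_const]
    have sk : ∀ {J : E4 → Mat}, SmoothMat U J → (∀ v ∈ U, G v * J v = -((J v)ᵀ * G v)) →
        ∀ i, G u * covEndo G i J u = -((covEndo G i J u)ᵀ * G u) := by
      intro J hs hJ i
      have h := zero (A := fun v => G v * J v + (J v)ᵀ * G v) i fun v hv => by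
        rw [hJ v hv, neg_add_cancel]
      rw [pdMat_add hG.isOpen hu (hG.smooth.mul hs) (hs.transpose.mul hG.smooth),
        pdMat_mul hG.isOpen hu hG.smooth hs, pdMat_mul hG.isOpen hu hs.transpose hG.smooth,
        pdMat_transpose, hG.pdMat_metric hu] at h
      have e := hJ u hu
      rw [← sub_eq_zero, sub_neg_eq_add]
      have e1 := congrArg (fun A => (connMat G i u)ᵀ * A) e
      have e2 := congrArg (fun A => A * connMat G i u) e
      rw [← sub_eq_zero] at e1 e2
      simp only [covEndo, transpose_sub, transpose_add, transpose_mul]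
      calc _ = ((connMat G i u)ᵀ * G u + G u * connMat G i u) * J u + G u * pdMat i J u
            + ((pdMat i J u)ᵀ * G u + (J u)ᵀ * ((connMat G i u)ᵀ * G u + G u * connMat G i u))
            - ((connMat G i u)ᵀ * (G u * J u) - (connMat G i u)ᵀ * -((J u)ᵀ * G u))
            - (G u * J u * connMat G i u - -((J u)ᵀ * G u) * connMat G i u) := by noncomm_ring
        _ = 0 := by rw [h, e1, e2]; simp
    have anti : ∀ {A B : E4 → Mat}, SmoothMat U A → SmoothMat U B →
        (∀ v ∈ U, A v * B v + B v * A v = 0) → ∀ i, covEndo G i A u * B u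
          + A u * covEndo G i B u + (covEndo G i B u * A u + B u * covEndo G i A u) = 0 := by
      intro A B hA hB h i
      rw [← hG.covEndo_mul hu hA hB, ← hG.covEndo_mul hu hB hA]
      have h' := zero i h
      rw [pdMat_add hG.isOpen hu (hA.mul hB) (hB.mul hA)] at h'
      calc _ = pdMat i (fun v => A v * B v) u + pdMat i (fun v => B v * A v) u
            + (connMat G i u * (A u * B u + B u * A u)
              - (A u * B u + B u * A u) * connMat G i u) := by simp only [covEndo]; noncomm_ring
        _ = 0 := by rw [h', h u hu]; simp
    have sq : ∀ {A : E4 → Mat}, SmoothMat U A → (∀ v ∈ U, A v * A v = -1) →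
        ∀ i, covEndo G i A u * A u + A u * covEndo G i A u = 0 := by
      intro A hA h i
      rw [← hG.covEndo_mul hu hA hA, hG.covEndo_congr hu h]
      simp [covEndo, pdMat_const]
    have lee' : ∀ i j k, ((covEndo G i J₁ u)ᵀ * G u) j k + ((covEndo G j J₁ u)ᵀ * G u) k i
        + ((covEndo G k J₁ u)ᵀ * G u) i j = -2 * wedge (t u) ((J₁ u)ᵀ * G u) i j k := by
      intro i j k
      rw [← lee u hu, hG.dTwo_eq hu, hG.covForm_transpose_mul hu s₁, hG.covForm_transpose_mul hu s₁,
        hG.covForm_transpose_mul hu s₁]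
      rw [transpose_mul, transpose_transpose, Q.symm, Q.skew₁]
    exact Q.covariant_derivatives
      (sk s₁ fun v hv => (quat v hv).skew₁) (sk s₂ fun v hv => (quat v hv).skew₂)
      (sk s₃ fun v hv => (quat v hv).skew₃)
      (sq s₁ fun v hv => (quat v hv).mul₁₁) (sq s₂ fun v hv => (quat v hv).mul₂₂)
      (sq s₃ fun v hv => (quat v hv).mul₃₃)
      (anti s₁ s₂ fun v hv => by rw [(quat v hv).mul₁₂, (quat v hv).mul₂₁, add_neg_cancel])
      (anti s₂ s₃ fun v hv => by rw [(quat v hv).mul₂₃, (quat v hv).mul₃₂, add_neg_cancel])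
      (anti s₃ s₁ fun v hv => by rw [(quat v hv).mul₃₁, (quat v hv).mul₁₃, add_neg_cancel])
      (fun k i j => by rw [← hG.nijenhuis_eq hu]; exact N₁ u hu k i j)
      (fun k i j => by rw [← hG.nijenhuis_eq hu]; exact N₂ u hu k i j) lee'
  exact ⟨hG, quat, s₁, s₂, s₃, ht, fun u hu i => (cov u hu i).1, fun u hu i => (cov u hu i).2.1,
    fun u hu i => (cov u hu i).2.2⟩

/-- The Weyl tensor and the derivatives of the Faraday form of a self-dual Einstein metric with a
parallel anti-self-dual triple. -/
theorem weylPlus_eq (H : IsWeylParallel U G J₁ J₂ J₃ t)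
    (hE : ∀ u ∈ U, ricci₀ G u = 0)
    (hW : ∀ u ∈ U, ∀ ψ : Mat, ψᵀ = -ψ → weylMinus G u ψ = 0)
    (a₁ : ∀ u ∈ U, IsAntiSelfDualForm (G u) ((J₁ u)ᵀ * G u))
    (a₂ : ∀ u ∈ U, IsAntiSelfDualForm (G u) ((J₂ u)ᵀ * G u))
    (a₃ : ∀ u ∈ U, IsAntiSelfDualForm (G u) ((J₃ u)ᵀ * G u)) (hu : u ∈ U) :
    (t u ≠ 0 → ∀ ψ : Mat, IsSelfDualForm (G u) ψ →
      weylPlus G u ψ = (1 / 2 : ℝ) • bracket (G u) ψ (dOne t u)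
        + (1 / normSq (G u) (t u)) • covDeriv G (dOne t) u
          ((toEndo (G u) ψ).mulVec (sharp (G u) (t u)))) ∧
    covDeriv G (dOne t) u (sharp (G u) (t u)) = (2 * normSq (G u) (t u)) • dOne t u ∧
    ∀ i : Fin 4, pd i (fun v => normSq (G v) (t v)) u
      - (scal G u / 12 + normSq (G u) (t u)) * t u i
      + (G u).mulVec ((toEndo (G u) (dOne t u)).mulVec (sharp (G u) (t u))) i = 0 := by
  have Q := H.quat u hu
  have hG := H.metric
  have hC : ∀ v ∈ U, IsScalarCurv G J₁ J₂ J₃ (scal G) v := fun v hv i j =>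
    ⟨hG.trace_mul_curvMat hv (hE v hv) (hW v hv) (a₁ v hv) i j,
      hG.trace_mul_curvMat hv (hE v hv) (hW v hv) (a₂ v hv) i j,
      hG.trace_mul_curvMat hv (hE v hv) (hW v hv) (a₃ v hv) i j⟩
  have hv : sharp (G u) (t u) = (G u)⁻¹ *ᵥ t u := rfl
  have hn : normSq (G u) (t u) = t u ⬝ᵥ sharp (G u) (t u) := normSq_eq _ _
  obtain ⟨hT, e₁, e₂, e₃⟩ := H.covOne_eq hu (hC u hu)
  have skewC := fun i j => hG.curvMat_skew hu i j
  have hEk := H.covForm_dOne_apply hC hG.smooth_scal hu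
  have hd := Q.differential_eq hv (fun i j k l => by
      rw [← hG.riemannLow_eq hu, hG.riemannLow_pair hu, hG.riemannLow_eq hu])
    (fun i j => (hC u hu i j).1) (fun k => H.covForm_dOne_commute hC hu k) e₁ e₂ hT hEk
  refine ⟨fun ht ψ hψ => ?_, ?_, fun i => ?_⟩
  · have hn0 : normSq (G u) (t u) ≠ 0 := by
      have hs : sharp (G u) (t u) ≠ 0 := by
        intro h
        apply ht
        rw [← Q.dotProduct_inv_mulVec hv, h, mulVec_zero]
      have := Q.pos _ hs
      rw [Q.dotProduct_inv_mulVec hv, dotProduct_comm, ← hn] at this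
      exact this.ne'
    have comm : ∀ {J : Mat}, IsAntiSelfDualForm (G u) (Jᵀ * G u) →
        toEndo (G u) ψ * J = J * toEndo (G u) ψ := by
      intro J hJ
      have := toEndo_commute Q.symm hψ hJ
      rwa [toEndo_eq (G u) (Jᵀ * G u), mul_assoc, hG.mul_inv hu, mul_one, transpose_transpose]
        at this
    -- On a form fixed by the star, W⁺ coincides with the full Weyl operator.
    have hw : weylPlus G u ψ = weylOp G u ψ := by
      rw [weylPlus, hψ.2, ← two_smul ℝ, smul_smul]
      norm_num
    ext i j
    have h := Q.weyl_identity hv skewC (fun i j => (hC u hu i j).1) (fun i j => (hC u hu i j).2.1)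
      (fun i j => (hC u hu i j).2.2) (transpose_dOne t u) e₁ e₂ e₃ hT hEk hd hψ.1 rfl
      (comm (a₁ u hu)) (comm (a₂ u hu)) (comm (a₃ u hu)) i j
    rw [hw, hG.weylOp_eq hu (hE u hu) hψ.1, covDeriv_eq_sum, Matrix.add_apply, Matrix.smul_apply,
      Matrix.smul_apply, smul_eq_mul, smul_eq_mul, h, ← hn]
    field_simp
    ring
  · rw [covDeriv_eq_sum, hn]
    exact Q.derivative_along_dual hv skewC (transpose_dOne t u) hT hEk hd
  -- d|θ|² is twice Dθ contracted with θ, so the formula for Dθ suffices; the endomorphism of Φ,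
  -- lowered by the metric, is −Φ as a matrix.
  · rw [hG.pd_normSq hu H.smooth_form, ← hv, hT, toEndo_eq_neg Q.symm (transpose_dOne t u),
      neg_mulVec, mulVec_neg, mulVec_mulVec, ← mul_assoc, Q.mul_inv, one_mul]
    simp only [add_mulVec, smul_mulVec, vecMulVec_mulVec, Q.dotProduct_inv_mulVec hv,
      Pi.add_apply, Pi.smul_apply, Pi.neg_apply, smul_eq_mul, op_smul_eq_smul, ← hn]
    ring

end IsWeylParallel

/-! ### From tensor fields on the manifold to matrices in a chart. -/

section Chart

variable {M : Type*} [TopologicalSpace M] [ChartedSpace E4 M]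
  {e : OpenPartialHomeomorph M E4} {u : E4}
  {J : EndoField M} {θ : CovectorField M}

theorem eq_sum_frame (he : e ∈ IsManifold.maximalAtlas (𝓡 4) ∞ M) (hu : u ∈ e.target)
    (v : TangentSpace (𝓡 4) (e.symm u)) :
    v = ∑ k, asVector (mfderiv (𝓡 4) (𝓡 4) e (e.symm u) v) k • frame e u k := by
  have hd : e.MDifferentiable (𝓡 4) (𝓡 4) :=
    ⟨(contMDiffOn_of_mem_maximalAtlas he).mdifferentiableOn (by simp),
      (contMDiffOn_symm_of_mem_maximalAtlas he).mdifferentiableOn (by simp)⟩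
  let A : E4 →L[ℝ] E4 := mfderiv (𝓡 4) (𝓡 4) e (e.symm u)
  let B : E4 →L[ℝ] E4 := mfderiv (𝓡 4) (𝓡 4) e.symm u
  -- Differentiating e ∘ e.symm = id gives AB = 1; finite dimension makes it two-sided, so the
  -- coordinate vectors span.
  have hAB : (A : E4 →ₗ[ℝ] E4) * (B : E4 →ₗ[ℝ] E4) = 1 := by
    ext1 w
    exact congrArg (fun f : E4 →L[ℝ] E4 => f w) (hd.comp_symm_deriv hu)
  have hBA : B (A v) = v :=
    congrArg (fun f : E4 →ₗ[ℝ] E4 => f v) (_root_.mul_eq_one_comm.1 hAB)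
  have hw : ∀ w : E4, w = ∑ k, w k • (EuclideanSpace.single k (1 : ℝ) : E4) := by
    intro w
    have := (EuclideanSpace.basisFun (Fin 4) ℝ).sum_repr w
    simpa using this.symm
  have key : B (A v) = ∑ k, (A v) k • B (EuclideanSpace.single k (1 : ℝ)) := by
    conv_lhs => rw [hw (A v)]
    simp
  exact hBA.symm.trans key

theorem asVector_frame (he : e ∈ IsManifold.maximalAtlas (𝓡 4) ∞ M) (hu : u ∈ e.target)
    (k : Fin 4) :
    asVector (mfderiv (𝓡 4) (𝓡 4) e (e.symm u) (frame e u k)) = EuclideanSpace.single k 1 := by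
  have hd : e.MDifferentiable (𝓡 4) (𝓡 4) :=
    ⟨(contMDiffOn_of_mem_maximalAtlas he).mdifferentiableOn (by simp),
      (contMDiffOn_symm_of_mem_maximalAtlas he).mdifferentiableOn (by simp)⟩
  exact congrArg (fun f : E4 →L[ℝ] E4 => f (EuclideanSpace.single k (1 : ℝ)))
    (hd.comp_symm_deriv hu)

theorem asVector_mfderiv_sum (c : Fin 4 → ℝ) (w : Fin 4 → TangentSpace (𝓡 4) (e.symm u))
    (i : Fin 4) :
    asVector (mfderiv (𝓡 4) (𝓡 4) e (e.symm u) (∑ k, c k • w k)) i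
      = ∑ k, c k * asVector (mfderiv (𝓡 4) (𝓡 4) e (e.symm u) (w k)) i := by
  have h : ∀ (A : E4 →L[ℝ] E4) (w : Fin 4 → E4),
      A (∑ k, c k • w k) i = ∑ k, c k * A (w k) i := by
    intro A w
    simp
  exact h (mfderiv (𝓡 4) (𝓡 4) e (e.symm u)) w

theorem endo_frame (he : e ∈ IsManifold.maximalAtlas (𝓡 4) ∞ M) (hu : u ∈ e.target)
    (J : EndoField M) (j : Fin 4) :
    J (e.symm u) (frame e u j) = ∑ i, endoIn J e u i j • frame e u i :=
  eq_sum_frame he hu _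

theorem endoIn_mul (he : e ∈ IsManifold.maximalAtlas (𝓡 4) ∞ M) (hu : u ∈ e.target)
    (J J' : EndoField M) :
    endoIn J e u * endoIn J' e u = endoIn (fun x => (J x).comp (J' x)) e u := by
  ext i j
  simp only [endoIn, of_apply, ContinuousLinearMap.comp_apply]
  rw [endo_frame he hu J' j, mul_apply, map_sum]
  simp only [map_smul]
  rw [asVector_mfderiv_sum]
  exact Finset.sum_congr rfl fun k _ => mul_comm _ _

theorem endoIn_neg (J : EndoField M) : endoIn (fun x => -J x) e u = -endoIn J e u := by
  ext i j
  have h : ∀ (A : E4 →L[ℝ] E4) (w : E4), A (-w) i = -A w i := by simp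
  exact h (mfderiv (𝓡 4) (𝓡 4) e (e.symm u)) _

theorem endoIn_id (he : e ∈ IsManifold.maximalAtlas (𝓡 4) ∞ M) (hu : u ∈ e.target) :
    endoIn (fun x => ContinuousLinearMap.id ℝ (TangentSpace (𝓡 4) x)) e u = 1 := by
  ext i j
  simp only [endoIn, of_apply, ContinuousLinearMap.id_apply, asVector_frame he hu]
  simp [one_apply]

theorem covectorIn_ne_zero (he : e ∈ IsManifold.maximalAtlas (𝓡 4) ∞ M) (hu : u ∈ e.target)
    (h : θ (e.symm u) ≠ 0) : covectorIn θ e u ≠ 0 := by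
  contrapose! h
  ext v
  rw [eq_sum_frame he hu v]
  have : ∀ k, θ (e.symm u) (frame e u k) = 0 := fun k => congrFun h k
  simp [this]

variable [IsManifold (𝓡 4) ∞ M] {g : Metric M}

theorem kaehlerIn_eq (he : e ∈ IsManifold.maximalAtlas (𝓡 4) ∞ M) (hu : u ∈ e.target)
    (g : Metric M) (J : EndoField M) :
    kaehlerIn g J e u = (endoIn J e u)ᵀ * metricIn g e u := by
  ext i j
  simp only [kaehlerIn, of_apply]
  rw [endo_frame he hu J i, mul_apply]
  simp [metricIn]

theorem transpose_metricIn (g : Metric M) : (metricIn g e u)ᵀ = metricIn g e u := by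
  ext i j
  exact g.symm _ _ _

theorem metricIn_pos (he : e ∈ IsManifold.maximalAtlas (𝓡 4) ∞ M) (hu : u ∈ e.target)
    (g : Metric M) {v : Fin 4 → ℝ} (hv : v ≠ 0) : 0 < v ⬝ᵥ metricIn g e u *ᵥ v := by
  have hw : ∑ k, v k • frame e u k ≠ 0 := by
    intro h
    apply hv
    ext i
    have h' := asVector_mfderiv_sum v (frame e u) i
    simp only [h, asVector_frame he hu, map_zero] at h'
    have h0 : asVector (0 : TangentSpace (𝓡 4) (e (e.symm u))) i = 0 := rfl
    simpa [h0, Pi.single_apply] using h'.symm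
  convert! g.pos _ _ hw using 1
  simp [dotProduct, mulVec, metricIn, Finset.mul_sum]
  refine Finset.sum_congr rfl fun i _ => Finset.sum_congr rfl fun j _ => ?_
  rw [g.symm]
  ring

theorem IsAlmostHermitian.endoIn_sq (hJ : IsAlmostHermitian g J)
    (he : e ∈ IsManifold.maximalAtlas (𝓡 4) ∞ M) (hu : u ∈ e.target) :
    endoIn J e u * endoIn J e u = -1 := by
  rw [endoIn_mul he hu, ← endoIn_id he hu, ← endoIn_neg]
  congr 1
  funext x
  ext1 v
  exact hJ.sq x v

/-- Orthogonality reads JᵀGJ = G; multiplying by J on the right and using J² = −1 gives skewness. -/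
theorem IsAlmostHermitian.endoIn_skew (hJ : IsAlmostHermitian g J)
    (he : e ∈ IsManifold.maximalAtlas (𝓡 4) ∞ M) (hu : u ∈ e.target) :
    metricIn g e u * endoIn J e u = -((endoIn J e u)ᵀ * metricIn g e u) := by
  have h : (endoIn J e u)ᵀ * metricIn g e u * endoIn J e u = metricIn g e u := by
    rw [← kaehlerIn_eq he hu]
    ext i j
    have := hJ.orthogonal (e.symm u) (frame e u i) (frame e u j)
    rw [endo_frame he hu J j] at this
    simp only [map_sum, map_smul, smul_eq_mul] at this
    rw [mul_apply]
    simp only [kaehlerIn, metricIn, of_apply]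
    rw [← this]
    exact Finset.sum_congr rfl fun k _ => mul_comm _ _
  conv_lhs => rw [← h]
  rw [mul_assoc, hJ.endoIn_sq he hu]
  simp

theorem contMDiffOn_frame (he : e ∈ IsManifold.maximalAtlas (𝓡 4) ∞ M) (i : Fin 4) :
    ContMDiffOn (𝓡 4) ((𝓡 4).prod 𝓘(ℝ, E4)) ∞
      (fun u => TotalSpace.mk' E4 (E := fun x : M => TangentSpace (𝓡 4) x) (e.symm u)
        (frame e u i)) e.target := by
  have hs := (contMDiffOn_symm_of_mem_maximalAtlas he).contMDiffOn_tangentMapWithin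
    (m := ∞) (by simp) e.open_target.uniqueMDiffOn
  have hc : ContMDiffOn (𝓡 4) ((𝓡 4).prod 𝓘(ℝ, E4)) ∞
      (fun u => (⟨u, (EuclideanSpace.single i (1 : ℝ) : E4)⟩ : TangentBundle (𝓡 4) E4))
      e.target :=
    contMDiffOn_vectorSpace_iff_contDiffOn.2 contDiffOn_const
  refine (hs.comp hc fun u hu => hu).congr fun u hu => ?_
  simp only [Function.comp_apply, tangentMapWithin, frame]
  rw [mfderivWithin_of_isOpen e.open_target hu]

theorem contDiffOn_covectorIn (he : e ∈ IsManifold.maximalAtlas (𝓡 4) ∞ M)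
    (hθ : IsSmoothOneForm θ) (i : Fin 4) :
    ContDiffOn ℝ ∞ (fun u => covectorIn θ e u i) e.target := by
  have h : ContMDiffOn (𝓡 4) ((𝓡 4).prod 𝓘(ℝ, ℝ)) ∞
      (fun u => TotalSpace.mk' ℝ (E := Bundle.Trivial M ℝ) (e.symm u)
        (θ (e.symm u) (frame e u i))) e.target := by
    apply ContMDiffOn.clm_bundle_apply (F₁ := E4) (E₁ := fun x : M => TangentSpace (𝓡 4) x)
    · exact hθ.comp_contMDiffOn (contMDiffOn_symm_of_mem_maximalAtlas he)
    · exact contMDiffOn_frame he i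
  intro u hu
  exact (contMDiffWithinAt_totalSpace.1 (h u hu)).2.contDiffWithinAt

theorem contDiffOn_inner (he : e ∈ IsManifold.maximalAtlas (𝓡 4) ∞ M) (g : Metric M)
    {v w : ∀ u : E4, TangentSpace (𝓡 4) (e.symm u)}
    (hv : ContMDiffOn (𝓡 4) ((𝓡 4).prod 𝓘(ℝ, E4)) ∞
      (fun u => TotalSpace.mk' E4 (E := fun x : M => TangentSpace (𝓡 4) x) (e.symm u) (v u))
      e.target)
    (hw : ContMDiffOn (𝓡 4) ((𝓡 4).prod 𝓘(ℝ, E4)) ∞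
      (fun u => TotalSpace.mk' E4 (E := fun x : M => TangentSpace (𝓡 4) x) (e.symm u) (w u))
      e.target) :
    ContDiffOn ℝ ∞ (fun u => g.inner (e.symm u) (v u) (w u)) e.target := by
  have h : ContMDiffOn (𝓡 4) ((𝓡 4).prod 𝓘(ℝ, ℝ)) ∞
      (fun u => TotalSpace.mk' ℝ (E := Bundle.Trivial M ℝ) (e.symm u)
        (g.inner (e.symm u) (v u) (w u))) e.target := by
    apply ContMDiffOn.clm_bundle_apply₂ (F₁ := E4) (F₂ := E4)
      (E₁ := fun x : M => TangentSpace (𝓡 4) x) (E₂ := fun x : M => TangentSpace (𝓡 4) x)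
    · exact g.contMDiff.comp_contMDiffOn (contMDiffOn_symm_of_mem_maximalAtlas he)
    · exact hv
    · exact hw
  intro u hu
  exact (contMDiffWithinAt_totalSpace.1 (h u hu)).2.contDiffWithinAt

theorem smoothMat_metricIn (he : e ∈ IsManifold.maximalAtlas (𝓡 4) ∞ M) (g : Metric M) :
    SmoothMat e.target (metricIn g e) := fun i j =>
  contDiffOn_inner he g (contMDiffOn_frame he i) (contMDiffOn_frame he j)

theorem smoothMat_kaehlerIn (he : e ∈ IsManifold.maximalAtlas (𝓡 4) ∞ M) (g : Metric M)
    (hJ : IsSmoothEndo J) : SmoothMat e.target (kaehlerIn g J e) := fun i j =>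
  contDiffOn_inner he g
    (ContMDiffOn.clm_bundle_apply (F₁ := E4) (F₂ := E4)
      (E₁ := fun x : M => TangentSpace (𝓡 4) x) (E₂ := fun x : M => TangentSpace (𝓡 4) x)
      (hJ.comp_contMDiffOn (contMDiffOn_symm_of_mem_maximalAtlas he))
      (contMDiffOn_frame he i))
    (contMDiffOn_frame he j)

theorem isLocalMetric_metricIn (he : e ∈ IsManifold.maximalAtlas (𝓡 4) ∞ M) (g : Metric M) :
    IsLocalMetric e.target (metricIn g e) where
  isOpen := e.open_target
  smooth := smoothMat_metricIn he g
  symm _ _ := transpose_metricIn g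
  det_ne_zero u hu h := by
    obtain ⟨v, hv, h0⟩ := exists_mulVec_eq_zero_iff.2 h
    have := metricIn_pos he hu g hv
    rw [h0, dotProduct_zero] at this
    exact this.false

/-- J is recovered from its Kähler form and the inverse metric, both of which have smooth components
because they only involve pairings of smooth sections. -/
theorem smoothMat_endoIn (he : e ∈ IsManifold.maximalAtlas (𝓡 4) ∞ M) (g : Metric M)
    (hJ : IsSmoothEndo J) : SmoothMat e.target (endoIn J e) := by
  have hG := isLocalMetric_metricIn he g
  refine ((smoothMat_kaehlerIn he g hJ).mul
    (hG.smooth.inv hG.det_ne_zero)).transpose.congr fun u hu => ?_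
  rw [kaehlerIn_eq he hu, mul_assoc, hG.mul_inv hu, mul_one, transpose_transpose]

/-- The indices are cyclic in `Fin 3`, so any member may come first; this lets the Lee equation be
assumed for an arbitrary one of the three. -/
theorem IsNegativeHyperhermitian.isQuaternionic {o : OrientedAtlas M} {I : Fin 3 → EndoField M}
    (hI : IsNegativeHyperhermitian o g I) (he : e ∈ IsManifold.maximalAtlas (𝓡 4) ∞ M)
    (hu : u ∈ e.target) (a : Fin 3) :
    IsQuaternionic (metricIn g e u) (endoIn (I a) e u) (endoIn (I (a + 1)) e u)
      (endoIn (I (a + 2)) e u) := by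
  have sq := fun b => (hI.almostHermitian b).endoIn_sq he hu
  have skew := fun b => (hI.almostHermitian b).endoIn_skew he hu
  have m₀₁ : endoIn (I 0) e u * endoIn (I 1) e u = endoIn (I 2) e u := by
    rw [endoIn_mul he hu]
    congr 1
    funext x
    ext1 v
    exact hI.mul x v
  have m₁₀ : endoIn (I 1) e u * endoIn (I 0) e u = -endoIn (I 2) e u := by
    rw [endoIn_mul he hu, ← endoIn_neg]
    congr 1
    funext x
    ext1 v
    exact hI.anticomm x v
  have m₁₂ : endoIn (I 1) e u * endoIn (I 2) e u = endoIn (I 0) e u := by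
    rw [← neg_neg (endoIn (I 2) e u), ← m₁₀, mul_neg, ← mul_assoc, sq 1]; simp
  have m₂₀ : endoIn (I 2) e u * endoIn (I 0) e u = endoIn (I 1) e u := by
    rw [← neg_neg (endoIn (I 2) e u), ← m₁₀, neg_mul, mul_assoc, sq 0]; simp
  have m₂₁ : endoIn (I 2) e u * endoIn (I 1) e u = -endoIn (I 0) e u := by
    rw [← m₀₁, mul_assoc, sq 1]; simp
  have m₀₂ : endoIn (I 0) e u * endoIn (I 2) e u = -endoIn (I 1) e u := by
    rw [← m₀₁, ← mul_assoc, sq 0]; simp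
  have symm := transpose_metricIn (e := e) (u := u) g
  have pos := fun v (hv : v ≠ 0) => metricIn_pos he hu g hv
  fin_cases a
  · exact ⟨symm, pos, sq 0, sq 1, sq 2, m₀₁, m₁₂, m₂₀, m₁₀, m₂₁, m₀₂, skew 0, skew 1, skew 2⟩
  · exact ⟨symm, pos, sq 1, sq 2, sq 0, m₁₂, m₂₀, m₀₁, m₂₁, m₀₂, m₁₀, skew 1, skew 2, skew 0⟩
  · exact ⟨symm, pos, sq 2, sq 0, sq 1, m₂₀, m₀₁, m₁₂, m₀₂, m₁₀, m₂₁, skew 2, skew 0, skew 1⟩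

theorem IsLeeForm.isWeylParallel {o : OrientedAtlas M} {I : Fin 3 → EndoField M}
    (hI : IsNegativeHyperhermitian o g I) {a : Fin 3} (hθ : IsLeeForm o g (I a) θ)
    (he : e ∈ o.charts) :
    IsWeylParallel e.target (metricIn g e) (endoIn (I a) e) (endoIn (I (a + 1)) e)
      (endoIn (I (a + 2)) e) (covectorIn θ e) := by
  have hm := o.smooth he
  have sm := fun b => smoothMat_endoIn hm g (hI.almostHermitian b).smooth
  refine .of_integrable (isLocalMetric_metricIn hm g) (fun u hu => hI.isQuaternionic hm hu a)
    (sm _) (sm _) (sm _) (contDiffOn_covectorIn hm hθ.smooth)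
    (hI.integrable a e he) (hI.integrable (a + 1) e he) fun u hu i j k => ?_
  have hF := fun v hv => kaehlerIn_eq (u := v) hm hv g (I a)
  have hp : ∀ l i j, pd l (fun v => ((endoIn (I a) e v)ᵀ * metricIn g e v) i j) u
      = pd l (fun v => kaehlerIn g (I a) e v i j) u := fun l i j =>
    pd_congr e.open_target hu (fun v hv => by rw [hF v hv]) l
  rw [← hF u hu, ← hθ.lee e he u hu i j k]
  simp only [dTwo, hp]

end Chart

end FourDim

/-! ### The theorem, in an arbitrary oriented chart. -/

theorem lemma4 {M : Type*} [TopologicalSpace M] [ChartedSpace FourDim.E4 M]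
    [IsManifold (𝓡 4) ∞ M]
    (o : FourDim.OrientedAtlas M) (g : FourDim.Metric M)
    (hE : FourDim.IsEinstein o g) (hSD : FourDim.IsSelfDual o g)
    (I : Fin 3 → FourDim.EndoField M) (hI : FourDim.IsNegativeHyperhermitian o g I)
    (θ : FourDim.CovectorField M) (a : Fin 3) (hθ : FourDim.IsLeeForm o g (I a) θ)
    (e : OpenPartialHomeomorph M FourDim.E4) (he : e ∈ o.charts)
    (u : FourDim.E4) (hu : u ∈ e.target) :
    let G : FourDim.E4 → FourDim.Mat := FourDim.metricIn g e
    let t : FourDim.E4 → Fin 4 → ℝ := FourDim.covectorIn θ e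
    let Φ : FourDim.E4 → FourDim.Mat := FourDim.dOne t
    let θv : Fin 4 → ℝ := FourDim.sharp (G u) (t u)
    let n : ℝ := FourDim.normSq (G u) (t u)
    -- `W⁺(ψ) = ½ [ψ, Φ] + |θ|⁻² D_{ψ(θ)} Φ` for self-dual `ψ`, where `θ` does not vanish
    (θ (e.symm u) ≠ 0 → ∀ ψ : FourDim.Mat, FourDim.IsSelfDualForm (G u) ψ →
      FourDim.weylPlus G u ψ =
        (1 / 2 : ℝ) • FourDim.bracket (G u) ψ (Φ u) +
          (1 / n) • FourDim.covDeriv G Φ u ((FourDim.toEndo (G u) ψ).mulVec θv)) ∧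
    -- `D_θ Φ = 2 |θ|² Φ`
    FourDim.covDeriv G Φ u θv = (2 * n) • Φ u ∧
    -- `d|θ|² - (s/12 + |θ|²) θ + Φ(θ) = 0`
    ∀ i : Fin 4,
      FourDim.pd i (fun v => FourDim.normSq (G v) (t v)) u
        - (FourDim.scal G u / 12 + n) * t u i
        + (G u).mulVec ((FourDim.toEndo (G u) (Φ u)).mulVec θv) i = 0 := by
  intro G t Φ θv n
  have hm := o.smooth he
  have anti : ∀ b, ∀ v ∈ e.target, FourDim.IsAntiSelfDualForm (FourDim.metricIn g e v)
      ((FourDim.endoIn (I b) e v).transpose * FourDim.metricIn g e v) := fun b v hv =>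
    FourDim.kaehlerIn_eq hm hv g (I b) ▸ hI.negative b e he v hv
  have h := (hθ.isWeylParallel hI he).weylPlus_eq (hE e he) (hSD e he) (anti _) (anti _)
    (anti _) hu
  exact ⟨fun h0 => h.1 (FourDim.covectorIn_ne_zero hm hu h0), h.2⟩
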